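/- Let $d\ge 2$ be an integer. Write $M_f$ for the operator of multiplication by a bounded function $f$ on $L_2(\mathbb R^d)$ (complex-valued functions, Lebesgue measure), let $\nabla=(-i\partial_1,\dots,-i\partial_d)$ and $\Delta=\sum_{k=1}^d\partial_k^2$, and for a bounded Borel function $h$ on $\mathbb R^d$ let $h(\nabla)$ be the Fourier multiplier with symbol $h$; thus $(1-\Delta)^{-p/2}$ has symbol $(1+|s|^2)^{-p/2}$ and, for $g\in C(\mathbb S^{d-1})$, the operator $g(\nabla(-\Delta)^{-1/2})$ has symbol $g(s/|s|)$. Let $\Pi$ be the $C^*$-subalgebra of $\mathcal B(L_2(\mathbb R^d))$ generated by $\{M_f: f\in\mathbb C+C_0(\mathbb R^d)\}$ and $\{g(\nabla(-\Delta)^{-1/2}): g\in C(\mathbb S^{d-1})\}$. An operator $T\in\mathcal B(L_2(\mathbb R^d))$ is called compactly supported if there is $\phi\in C_c^\infty(\mathbb R^d)$ with $T=M_\phi TM_\phi$. For $0<q<\infty$ let $\mathcal L_{q,\infty}$ be the set of compact operators $A$ on $L_2(\mathbb R^d)$ with $\|A\|_{q,\infty}=\sup_{n\ge 0}(n+1)^{1/q}\mu(n,A)<\infty$,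 where $\mu(n,A)=\inf\{\|A-R\|_\infty:\operatorname{rank}(R)\le n\}$ and $\|\cdot\|_\infty$ is the operator norm, and let $(\mathcal L_{q,\infty})_0$, the separable part of $\mathcal L_{q,\infty}$, be the closure of the set of finite rank operators with respect to $\|\cdot\|_{q,\infty}$. Theorem. If $T\in\Pi$ is compactly supported, then for every real $p>0$ $$[T,(1-\Delta)^{-p/2}]=T(1-\Delta)^{-p/2}-(1-\Delta)^{-p/2}T\in(\mathcal L_{d/p,\infty})_0 .$$ -/

import Mathlib

open MeasureTheory Metric FourierTransform
open scoped ENNReal ContDiff ZeroAtInfty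

noncomputable section

namespace CommutatorBound

/-! ### Singular values and weak Schatten classes -/

section WeakSchatten

variable {H : Type*} [NormedAddCommGroup H] [InnerProductSpace ℂ H]

/-- The singular value `μ(n, T) = inf {‖T - R‖ : rank R ≤ n}` of a bounded operator. -/
def singularValue (n : ℕ) (T : H →L[ℂ] H) : ℝ :=
  sInf {r : ℝ | ∃ R : H →L[ℂ] H, LinearMap.rank (R : H →ₗ[ℂ] H) ≤ (n : Cardinal) ∧ r = ‖T - R‖}

/-- The quasi-norm `‖T‖_{q,∞} = sup_{n ≥ 0} (n + 1)^{1/q} μ(n, T)`, with value `∞` allowed. -/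
def weakSchattenNorm (q : ℝ) (T : H →L[ℂ] H) : ℝ≥0∞ :=
  ⨆ n : ℕ, ENNReal.ofReal (((n : ℝ) + 1) ^ (1 / q) * singularValue n T)

/-- The weak Schatten class `L_{q,∞}`: the compact operators with finite quasi-norm. -/
def weakSchatten (H : Type*) [NormedAddCommGroup H] [InnerProductSpace ℂ H] (q : ℝ) :
    Set (H →L[ℂ] H) :=
  {T | IsCompactOperator T ∧ weakSchattenNorm q T < ⊤}

/-- The separable part `(L_{q,∞})_0` of `L_{q,∞}`: the closure, in the quasi-norm of `L_{q,∞}`,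
of the set of finite rank operators. -/
def weakSchattenSep (H : Type*) [NormedAddCommGroup H] [InnerProductSpace ℂ H] (q : ℝ) :
    Set (H →L[ℂ] H) :=
  {T | T ∈ weakSchatten H q ∧ ∀ ε : ℝ≥0∞, 0 < ε → ∃ F : H →L[ℂ] H,
    LinearMap.rank (F : H →ₗ[ℂ] H) < Cardinal.aleph0 ∧ weakSchattenNorm q (T - F) < ε}

end WeakSchatten

/-! ### Multiplication operators and Fourier multipliers on `L_2(ℝ^d)` -/

/-- The space `ℝ^d` with its Euclidean norm. -/
abbrev Rd (d : ℕ) : Type := EuclideanSpace ℝ (Fin d)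

/-- The complex Hilbert space `L_2(ℝ^d)` for Lebesgue measure. -/
abbrev L2 (d : ℕ) : Type := Lp ℂ 2 (volume : Measure (Rd d))

/-- Bounded Borel functions on `ℝ^d`. -/
def IsBoundedBorel {d : ℕ} (f : Rd d → ℂ) : Prop :=
  Measurable f ∧ ∃ C : ℝ, ∀ x, ‖f x‖ ≤ C

theorem IsBoundedBorel.memLp {d : ℕ} {f : Rd d → ℂ} (hf : IsBoundedBorel f) :
    MemLp f ∞ (volume : Measure (Rd d)) := by
  obtain ⟨hm, C, hC⟩ := hf
  exact memLp_top_of_bound hm.aestronglyMeasurable C (Filter.Eventually.of_forall hC)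

theorem IsBoundedBorel.comp_smul {d : ℕ} {f : Rd d → ℂ} (hf : IsBoundedBorel f) (r : ℝ) :
    IsBoundedBorel (fun x => f (r • x)) := by
  obtain ⟨hm, C, hC⟩ := hf
  exact ⟨hm.comp (measurable_const_smul r), C, fun x => hC _⟩

/-- The operator `M_f` of multiplication by the bounded Borel function `f` on `L_2(ℝ^d)`. -/
def mulOp {d : ℕ} (f : Rd d → ℂ) (hf : IsBoundedBorel f) : L2 d →L[ℂ] L2 d :=
  (ContinuousLinearMap.mul ℂ ℂ).holderL volume ∞ 2 2 (hf.memLp.toLp f)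

theorem mulOp_apply_ae {d : ℕ} (f : Rd d → ℂ) (hf : IsBoundedBorel f) (u : L2 d) :
    mulOp f hf u =ᵐ[volume] fun x => f x * u x := by
  have h := (ContinuousLinearMap.mul ℂ ℂ).coeFn_holder (r := 2) (hf.memLp.toLp f) u
  filter_upwards [h, hf.memLp.coeFn_toLp] with x hx hx'
  rw [← hx']
  exact hx

/-- The operator `g(∇)`, for `∇ = (-i ∂_1, …, -i ∂_d)` and a bounded Borel function `g`.
Mathlib's Fourier transform `(𝓕 u)(ξ) = ∫ e^{-2πi⟨x,ξ⟩} u(x) dx` turns `∇` into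
multiplication by `2πξ`, so that `g(∇) = 𝓕⁻¹ M_{g(2π ·)} 𝓕`. -/
def gradOp {d : ℕ} (g : Rd d → ℂ) (hg : IsBoundedBorel g) : L2 d →L[ℂ] L2 d :=
  ((Lp.fourierTransformₗᵢ (Rd d) ℂ).symm.toContinuousLinearEquiv : L2 d →L[ℂ] L2 d) ∘L
    mulOp (fun ξ => g ((2 * Real.pi) • ξ)) (hg.comp_smul _) ∘L
    ((Lp.fourierTransformₗᵢ (Rd d) ℂ).toContinuousLinearEquiv : L2 d →L[ℂ] L2 d)

theorem fourier_gradOp_ae {d : ℕ} (g : Rd d → ℂ) (hg : IsBoundedBorel g) (u : L2 d) :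
    (𝓕 (gradOp g hg u) : L2 d) =ᵐ[volume]
      fun ξ => g ((2 * Real.pi) • ξ) * (𝓕 u : L2 d) ξ := by
  have h : (𝓕 (gradOp g hg u) : L2 d) =
      mulOp (fun ξ => g ((2 * Real.pi) • ξ)) (hg.comp_smul _) (𝓕 u : L2 d) :=
    (Lp.fourierTransformₗᵢ (Rd d) ℂ).apply_symm_apply _
  rw [h]
  exact mulOp_apply_ae _ _ _

/-! ### The operator `(1 - Δ)^{-p/2}` -/

/-- The symbol `(1 + |s|^2)^{-p/2}`. -/
def besselSymbol (d : ℕ) (p : ℝ) : Rd d → ℂ :=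
  fun s => (((1 + ‖s‖ ^ 2) ^ (-(p / 2)) : ℝ) : ℂ)

theorem isBoundedBorel_besselSymbol (d : ℕ) {p : ℝ} (hp : 0 < p) :
    IsBoundedBorel (besselSymbol d p) := by
  refine ⟨?_, 1, fun s => ?_⟩
  · unfold besselSymbol
    fun_prop
  · have h1 : (1 : ℝ) ≤ 1 + ‖s‖ ^ 2 := by nlinarith [sq_nonneg ‖s‖]
    have h0 : (0 : ℝ) ≤ 1 + ‖s‖ ^ 2 := by linarith
    rw [besselSymbol, Complex.norm_real, Real.norm_of_nonneg (Real.rpow_nonneg h0 _)]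
    exact Real.rpow_le_one_of_one_le_of_nonpos h1 (by linarith)

/-- The operator `(1 - Δ)^{-p/2}` on `L_2(ℝ^d)`, for `p > 0`. -/
def besselOp (d : ℕ) (p : ℝ) (hp : 0 < p) : L2 d →L[ℂ] L2 d :=
  gradOp (besselSymbol d p) (isBoundedBorel_besselSymbol d hp)

/-! ### The algebra `Π` -/

theorem inv_norm_smul_mem_sphere {d : ℕ} {s : Rd d} (hs : s ≠ 0) :
    ‖s‖⁻¹ • s ∈ sphere (0 : Rd d) 1 := by
  have h : ‖s‖ ≠ 0 := norm_ne_zero_iff.mpr hs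
  simp [norm_smul, h]

/-- The symbol `s ↦ g(s / |s|)` of `g(∇(-Δ)^{-1/2})`, set to `0` at the origin. -/
def sphereSymbol {d : ℕ} (g : C(sphere (0 : Rd d) 1, ℂ)) : Rd d → ℂ := by
  classical
  exact fun s => if hs : s = 0 then 0 else g ⟨‖s‖⁻¹ • s, inv_norm_smul_mem_sphere hs⟩

theorem isBoundedBorel_sphereSymbol {d : ℕ} (g : C(sphere (0 : Rd d) 1, ℂ)) :
    IsBoundedBorel (sphereSymbol g) := by
  classical
  refine ⟨?_, ‖g‖, fun s => ?_⟩
  · refine Measurable.dite (s := {s : Rd d | s = 0}) (f := fun _ => (0 : ℂ))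
      (g := fun s => g ⟨‖s.1‖⁻¹ • s.1, inv_norm_smul_mem_sphere s.2⟩)
      measurable_const ?_ (measurableSet_singleton 0)
    have hc : Continuous (fun s : ({s : Rd d | s = 0}ᶜ : Set (Rd d)) =>
        (⟨‖s.1‖⁻¹ • s.1, inv_norm_smul_mem_sphere s.2⟩ : sphere (0 : Rd d) 1)) := ?_
    · exact ((map_continuous g).comp hc).measurable
    have hi : Continuous (fun s : ({s : Rd d | s = 0}ᶜ : Set (Rd d)) => ‖s.1‖⁻¹) :=
      Continuous.inv₀ (by fun_prop) fun s => norm_ne_zero_iff.mpr s.2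
    exact Continuous.subtype_mk (hi.smul continuous_subtype_val) _
  · unfold sphereSymbol
    split_ifs with hs
    · simp
    · exact g.norm_coe_le_norm _

theorem isBoundedBorel_const_add {d : ℕ} (c : ℂ) (f : C₀(Rd d, ℂ)) :
    IsBoundedBorel (fun x => c + f x) := by
  refine ⟨((continuous_const (y := c)).add (map_continuous f)).measurable, ‖c‖ + ‖f.toBCF‖, fun x => ?_⟩
  exact (norm_add_le _ _).trans (add_le_add le_rfl (f.toBCF.norm_coe_le_norm x))

/-- The multiplication operators `M_f` with `f ∈ ℂ + C_0(ℝ^d)`. -/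
def mulAlg (d : ℕ) : Set (L2 d →L[ℂ] L2 d) :=
  {S | ∃ (c : ℂ) (f : C₀(Rd d, ℂ)), S = mulOp (fun x => c + f x) (isBoundedBorel_const_add c f)}

/-- The operators `g(∇(-Δ)^{-1/2})` with `g ∈ C(𝕊^{d-1})`. -/
def sphereAlg (d : ℕ) : Set (L2 d →L[ℂ] L2 d) :=
  {S | ∃ g : C(sphere (0 : Rd d) 1, ℂ), S = gradOp (sphereSymbol g) (isBoundedBorel_sphereSymbol g)}

/-- The C*-algebra `Π` of bounded operators on `L_2(ℝ^d)` generated by the two families above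
(the norm closure of the star-algebra they generate). -/
def PiAlg (d : ℕ) : StarSubalgebra ℂ (L2 d →L[ℂ] L2 d) :=
  (StarAlgebra.adjoin ℂ (mulAlg d ∪ sphereAlg d)).topologicalClosure

/-! ### Compactly supported operators -/

theorem isBoundedBorel_of_compactSupport {d : ℕ} {φ : Rd d → ℂ} (hφ : ContDiff ℝ ∞ φ)
    (hc : HasCompactSupport φ) : IsBoundedBorel φ :=
  ⟨hφ.continuous.measurable, hφ.continuous.bounded_above_of_compact_support hc⟩

/-- `T` is compactly supported if `T = M_φ T M_φ` for some `φ ∈ C_c^∞(ℝ^d)`. -/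
def IsCompactlySupported {d : ℕ} (T : L2 d →L[ℂ] L2 d) : Prop :=
  ∃ (φ : Rd d → ℂ) (hφ : ContDiff ℝ ∞ φ) (hc : HasCompactSupport φ),
    T = mulOp φ (isBoundedBorel_of_compactSupport hφ hc) ∘L T ∘L
      mulOp φ (isBoundedBorel_of_compactSupport hφ hc)

end CommutatorBound

end

/-! Write `J` for `(1 - Δ)^{-p/2}`. Membership in the separable part of `L_{d/p,∞}` follows from
`μ(n) = o(n^{-p/d})` (`IsWeakSmall.mem_weakSchattenSep`), so everything is phrased through
approximation by operators of rank at most `n`.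

The operators `S` for which `[S, J]` has this little-o property form a star-algebra `commAlg`: the
property is stable under sums, adjoints and composition with bounded operators, commutators obey the
Leibniz rule, and `J` is self-adjoint. It contains the multipliers `g(∇(-Δ)^{-1/2})`, which commute
with `J`, and `M_f` for `f` smooth with compact support, because `[M_f, J]` gains one order over
`J`. Hence `Π` lies in the operator-norm closure of `commAlg`.

Norm limits alone do not control weak Schatten quasi-norms; this is where compact support enters. If
`T = M T M` with `M = M_φ`, and `S` in `commAlg` is close to `T` in norm, then `[T, J] - [M S M, J]
= M (T - S) (M J) - (J M) (T - S) M`. Since `M J` and `J M` lie in `L_{d/p,∞}`, the error is `O(‖T -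
S‖)` in the quasi-norm, and the little-o class is closed under such limits.

Both analytic inputs (`M_χ J` in `L_{d/p,∞}` and `M_χ [M_f, J]` in `L_{d/(p+1),∞}`) come from
`isWeakBounded_of_fourier_decay`. For `A` with range supported in a cube, expand in the exponentials
`e_k` of the cube. If the Fourier transform of `A* e_k` is concentrated near the frequency `κ` of
`e_k` and has size `(1 + |κ|)^{-s}`, a Schur test bounds the part of `A` outside the box `|k_i| ≤ N`
by `O(N^{-s})`. The box contributes rank `(2N+1)^d`, whence `μ(n) = O(n^{-s/d})`. The case `s = p`
uses the decay of the symbol of `J`; `s = p + 1` uses the mean value theorem for that symbol. -/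

noncomputable section

namespace CommutatorBound

/-! ### Rank approximation, weak Schatten growth rates, and the separable part. -/

section RankApprox

variable {H : Type*} [NormedAddCommGroup H] [InnerProductSpace ℂ H]

/-- `A` is within distance `c` of an operator of rank at most `n`. -/
def RankApprox (n : ℕ) (c : ℝ) (A : H →L[ℂ] H) : Prop :=
  ∃ R : H →L[ℂ] H, LinearMap.rank (R : H →ₗ[ℂ] H) ≤ (n : Cardinal) ∧ ‖A - R‖ ≤ c

theorem RankApprox.mono {m n : ℕ} {a b : ℝ} {A : H →L[ℂ] H} (h : RankApprox m a A) (hmn : m ≤ n)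
    (hab : a ≤ b) : RankApprox n b A := by
  obtain ⟨R, hR, hA⟩ := h
  exact ⟨R, hR.trans (by exact_mod_cast hmn), hA.trans hab⟩

theorem RankApprox.of_norm_le {n : ℕ} {a : ℝ} {A : H →L[ℂ] H} (h : ‖A‖ ≤ a) :
    RankApprox n a A := by
  refine ⟨0, ?_, by simpa using h⟩
  have : LinearMap.rank ((0 : H →L[ℂ] H) : H →ₗ[ℂ] H) = 0 := by
    rw [LinearMap.rank, ContinuousLinearMap.toLinearMap_zero, LinearMap.range_zero]
    simp
  rw [this]
  exact zero_le

theorem RankApprox.add {m n : ℕ} {a b : ℝ} {A B : H →L[ℂ] H} (hA : RankApprox m a A)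
    (hB : RankApprox n b B) : RankApprox (m + n) (a + b) (A + B) := by
  obtain ⟨R, hR, hA⟩ := hA
  obtain ⟨S, hS, hB⟩ := hB
  refine ⟨R + S, ?_, ?_⟩
  · rw [ContinuousLinearMap.toLinearMap_add]
    push_cast
    exact (LinearMap.rank_add_le _ _).trans (add_le_add hR hS)
  · rw [add_sub_add_comm]
    exact (norm_add_le _ _).trans (add_le_add hA hB)

theorem RankApprox.comp_left {n : ℕ} {a : ℝ} {A : H →L[ℂ] H} (hA : RankApprox n a A)
    (B : H →L[ℂ] H) : RankApprox n (‖B‖ * a) (B ∘L A) := by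
  obtain ⟨R, hR, hA⟩ := hA
  refine ⟨B ∘L R, ?_, ?_⟩
  · rw [ContinuousLinearMap.toLinearMap_comp]
    exact (LinearMap.rank_comp_le_right _ _).trans hR
  · rw [← ContinuousLinearMap.comp_sub]
    exact (ContinuousLinearMap.opNorm_comp_le _ _).trans (by gcongr)

theorem RankApprox.comp_right {n : ℕ} {a : ℝ} {A : H →L[ℂ] H} (hA : RankApprox n a A)
    (B : H →L[ℂ] H) : RankApprox n (a * ‖B‖) (A ∘L B) := by
  obtain ⟨R, hR, hA⟩ := hA
  refine ⟨R ∘L B, ?_, ?_⟩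
  · rw [ContinuousLinearMap.toLinearMap_comp]
    exact (LinearMap.rank_comp_le_left _ _).trans hR
  · rw [← ContinuousLinearMap.sub_comp]
    exact (ContinuousLinearMap.opNorm_comp_le _ _).trans (by gcongr)

theorem RankApprox.smul {n : ℕ} {a : ℝ} {A : H →L[ℂ] H} (hA : RankApprox n a A) (c : ℂ) :
    RankApprox n (‖c‖ * a) (c • A) := by
  obtain ⟨R, hR, hA⟩ := hA
  refine ⟨c • R, ?_, ?_⟩
  · have : ((c • R : H →L[ℂ] H) : H →ₗ[ℂ] H) = (c • LinearMap.id).comp (R : H →ₗ[ℂ] H) := by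
      ext; simp
    rw [this]
    exact (LinearMap.rank_comp_le_right _ _).trans hR
  · rw [← smul_sub, norm_smul]
    gcongr

/-- With `P` the orthogonal projection onto the range of `R`, `R = P R` gives `R* = R* P`, and `P`
has the rank of `R`. -/
theorem rank_adjoint_le [CompleteSpace H] {n : ℕ} {R : H →L[ℂ] H}
    (hR : LinearMap.rank (R : H →ₗ[ℂ] H) ≤ (n : Cardinal)) :
    LinearMap.rank (ContinuousLinearMap.adjoint R : H →ₗ[ℂ] H) ≤ (n : Cardinal) := by
  set V : Submodule ℂ H := LinearMap.range (R : H →ₗ[ℂ] H) with hV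
  have hfin : FiniteDimensional ℂ V :=
    Module.rank_lt_aleph0_iff.mp (hR.trans_lt (Cardinal.natCast_lt_aleph0))
  have hP : R = V.starProjection ∘L R := by
    ext x
    have : R x ∈ V := ⟨x, rfl⟩
    simp [Submodule.starProjection_eq_self_iff.mpr this]
  have hadj : ContinuousLinearMap.adjoint R =
      ContinuousLinearMap.adjoint R ∘L V.starProjection := by
    conv_lhs => rw [hP, ContinuousLinearMap.adjoint_comp]
    congr 1
    exact (ContinuousLinearMap.isSelfAdjoint_iff'.mp (isSelfAdjoint_starProjection V))
  rw [hadj, ContinuousLinearMap.toLinearMap_comp]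
  refine (LinearMap.rank_comp_le_right _ _).trans ?_
  rw [LinearMap.rank]
  have : LinearMap.range (V.starProjection : H →ₗ[ℂ] H) = V := Submodule.range_starProjection V
  rw [this]
  exact hR

theorem RankApprox.adjoint [CompleteSpace H] {n : ℕ} {a : ℝ} {A : H →L[ℂ] H}
    (hA : RankApprox n a A) : RankApprox n a (ContinuousLinearMap.adjoint A) := by
  obtain ⟨R, hR, hA⟩ := hA
  refine ⟨ContinuousLinearMap.adjoint R, rank_adjoint_le hR, ?_⟩
  rw [← map_sub, LinearIsometryEquiv.norm_map]
  exact hA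

theorem RankApprox.singularValue_le {n : ℕ} {a : ℝ} {A : H →L[ℂ] H} (hA : RankApprox n a A) :
    singularValue n A ≤ a := by
  obtain ⟨R, hR, hA⟩ := hA
  refine le_trans (csInf_le ⟨0, ?_⟩ ⟨R, hR, rfl⟩) hA
  rintro r ⟨S, -, rfl⟩
  exact norm_nonneg _

/-- `μ(n, A) = O(n ^ (-α))`. -/
def IsWeakBounded (α : ℝ) (A : H →L[ℂ] H) : Prop :=
  ∃ C : ℝ, 0 ≤ C ∧ ∀ n : ℕ, RankApprox n (C * ((n : ℝ) + 1) ^ (-α)) A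

/-- `μ(n, A) = o(n ^ (-α))`. -/
def IsWeakSmall (α : ℝ) (A : H →L[ℂ] H) : Prop :=
  ∀ ε : ℝ, 0 < ε → ∃ n₀ : ℕ, ∀ n, n₀ ≤ n → RankApprox n (ε * ((n : ℝ) + 1) ^ (-α)) A

theorem rpow_neg_le_of_le_two_mul {α x y : ℝ} (hα : 0 ≤ α) (hx : 0 < x) (hxy : x ≤ 2 * y) :
    y ^ (-α) ≤ 2 ^ α * x ^ (-α) := by
  have hy : 0 < y := by linarith
  have h : (2 * y) ^ (-α) ≤ x ^ (-α) := Real.rpow_le_rpow_of_nonpos hx hxy (by linarith)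
  rw [Real.mul_rpow (by norm_num) hy.le, Real.rpow_neg (by norm_num)] at h
  have h2 : (0 : ℝ) < 2 ^ α := by positivity
  calc y ^ (-α) = 2 ^ α * ((2 ^ α)⁻¹ * y ^ (-α)) := by field_simp
    _ ≤ _ := by gcongr

theorem half_rpow_neg_le {α : ℝ} (hα : 0 ≤ α) (n : ℕ) :
    (((n / 2 : ℕ) : ℝ) + 1) ^ (-α) ≤ 2 ^ α * ((n : ℝ) + 1) ^ (-α) := by
  apply rpow_neg_le_of_le_two_mul hα (by positivity)
  have : n + 1 ≤ 2 * (n / 2 + 1) := by omega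
  exact_mod_cast this

/-- Each summand gets half of the available rank; replacing `n / 2` by `n` in the power costs the
factor `2 ^ α`. -/
theorem RankApprox.add_half {α : ℝ} (hα : 0 ≤ α) {n : ℕ} {a b : ℝ} (ha : 0 ≤ a) (hb : 0 ≤ b)
    {A B : H →L[ℂ] H} (hA : RankApprox (n / 2) (a * (((n / 2 : ℕ) : ℝ) + 1) ^ (-α)) A)
    (hB : RankApprox (n / 2) (b * (((n / 2 : ℕ) : ℝ) + 1) ^ (-α)) B) :
    RankApprox n (2 ^ α * (a + b) * ((n : ℝ) + 1) ^ (-α)) (A + B) := by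
  refine (hA.add hB).mono (by omega) ?_
  rw [← add_mul]
  calc (a + b) * (((n / 2 : ℕ) : ℝ) + 1) ^ (-α)
      ≤ (a + b) * (2 ^ α * ((n : ℝ) + 1) ^ (-α)) := by gcongr; exact half_rpow_neg_le hα n
    _ = _ := by ring

theorem IsWeakSmall.add {α : ℝ} (hα : 0 ≤ α) {A B : H →L[ℂ] H} (hA : IsWeakSmall α A)
    (hB : IsWeakSmall α B) : IsWeakSmall α (A + B) := by
  intro ε hε
  have hδ : 0 < ε / (2 ^ α * 2) := by positivity
  obtain ⟨m, hm⟩ := hA _ hδ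
  obtain ⟨n, hn⟩ := hB _ hδ
  refine ⟨2 * max m n, fun k hk => ?_⟩
  refine (RankApprox.add_half hα hδ.le hδ.le (hm (k / 2) (by omega))
    (hn (k / 2) (by omega))).mono le_rfl (le_of_eq ?_)
  field_simp
  ring

/-- The little-o class is closed under limits in the quasi-norm. This is what carries the result
from an approximant of `T` to `T` itself. -/
theorem IsWeakSmall.of_forall_approx {α : ℝ} (hα : 0 ≤ α) {A : H →L[ℂ] H}
    (h : ∀ ε : ℝ, 0 < ε → ∃ B : H →L[ℂ] H, IsWeakSmall α B ∧
      ∀ n : ℕ, RankApprox n (ε * ((n : ℝ) + 1) ^ (-α)) (A - B)) : IsWeakSmall α A := by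
  intro ε hε
  have hδ : 0 < ε / (2 ^ α * 2) := by positivity
  obtain ⟨B, hB, hAB⟩ := h _ hδ
  obtain ⟨m, hm⟩ := hB _ hδ
  refine ⟨2 * m, fun k hk => ?_⟩
  have := (RankApprox.add_half hα hδ.le hδ.le (hAB (k / 2)) (hm (k / 2) (by omega)))
  rw [sub_add_cancel] at this
  refine this.mono le_rfl (le_of_eq ?_)
  field_simp
  ring

theorem IsWeakSmall.of_forall_le {α : ℝ} {A B : H →L[ℂ] H} {C : ℝ} (hC : 0 ≤ C)
    (hA : IsWeakSmall α A)
    (h : ∀ (n : ℕ) (a : ℝ), 0 ≤ a → RankApprox n a A → RankApprox n (C * a) B) :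
    IsWeakSmall α B := by
  intro ε hε
  obtain ⟨m, hm⟩ := hA (ε / (C + 1)) (by positivity)
  refine ⟨m, fun n hn => (h n _ (by positivity) (hm n hn)).mono le_rfl ?_⟩
  rw [← mul_assoc]
  gcongr
  rw [mul_div_assoc', div_le_iff₀ (by positivity)]
  nlinarith

theorem IsWeakSmall.comp_left {α : ℝ} {A : H →L[ℂ] H} (hA : IsWeakSmall α A) (B : H →L[ℂ] H) :
    IsWeakSmall α (B ∘L A) :=
  hA.of_forall_le (norm_nonneg B) fun _ _ _ h => h.comp_left B

theorem IsWeakSmall.comp_right {α : ℝ} {A : H →L[ℂ] H} (hA : IsWeakSmall α A) (B : H →L[ℂ] H) :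
    IsWeakSmall α (A ∘L B) :=
  hA.of_forall_le (norm_nonneg B) fun _ a _ h => mul_comm a ‖B‖ ▸ h.comp_right B

theorem IsWeakSmall.smul {α : ℝ} {A : H →L[ℂ] H} (hA : IsWeakSmall α A) (c : ℂ) :
    IsWeakSmall α (c • A) :=
  hA.of_forall_le (norm_nonneg c) fun _ _ _ h => h.smul c

theorem IsWeakSmall.neg {α : ℝ} {A : H →L[ℂ] H} (hA : IsWeakSmall α A) :
    IsWeakSmall α (-A) := by
  simpa using hA.smul (-1)

theorem IsWeakSmall.adjoint [CompleteSpace H] {α : ℝ} {A : H →L[ℂ] H} (hA : IsWeakSmall α A) :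
    IsWeakSmall α (ContinuousLinearMap.adjoint A) :=
  hA.of_forall_le zero_le_one fun _ a _ h => (one_mul a).symm ▸ h.adjoint

theorem isWeakSmall_zero (α : ℝ) : IsWeakSmall α (0 : H →L[ℂ] H) :=
  fun ε hε => ⟨0, fun n _ => RankApprox.of_norm_le (by rw [norm_zero]; positivity)⟩

/-- Turns a gain in the order of decay into membership in the separable part. -/
theorem IsWeakBounded.isWeakSmall {α β : ℝ} (hαβ : α < β) {A : H →L[ℂ] H}
    (hA : IsWeakBounded β A) : IsWeakSmall α A := by
  obtain ⟨C, hC, h⟩ := hA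
  intro ε hε
  have hlim : Filter.Tendsto (fun n : ℕ => C * ((n : ℝ) + 1) ^ (-(β - α))) Filter.atTop
      (nhds (C * 0)) := by
    refine Filter.Tendsto.const_mul C ((tendsto_rpow_neg_atTop (sub_pos.mpr hαβ)).comp ?_)
    exact Filter.tendsto_atTop_add_const_right _ _ tendsto_natCast_atTop_atTop
  rw [mul_zero] at hlim
  obtain ⟨n₀, hn₀⟩ := Filter.eventually_atTop.mp (hlim.eventually (gt_mem_nhds hε))
  refine ⟨n₀, fun n hn => (h n).mono le_rfl ?_⟩
  have hpos : (0 : ℝ) < (n : ℝ) + 1 := by positivity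
  calc C * ((n : ℝ) + 1) ^ (-β) = C * ((n : ℝ) + 1) ^ (-(β - α)) * ((n : ℝ) + 1) ^ (-α) := by
        rw [mul_assoc, ← Real.rpow_add hpos]
        congr 2
        ring
    _ ≤ _ := by
        gcongr
        exact (hn₀ n hn).le

theorem IsWeakBounded.adjoint [CompleteSpace H] {α : ℝ} {A : H →L[ℂ] H}
    (hA : IsWeakBounded α A) : IsWeakBounded α (ContinuousLinearMap.adjoint A) := by
  obtain ⟨C, hC, h⟩ := hA
  exact ⟨C, hC, fun n => (h n).adjoint⟩

theorem isCompactOperator_of_rank_lt_aleph0 {R : H →L[ℂ] H}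
    (hR : LinearMap.rank (R : H →ₗ[ℂ] H) < Cardinal.aleph0) : IsCompactOperator R := by
  set V : Submodule ℂ H := LinearMap.range (R : H →ₗ[ℂ] H) with hV
  have hfin : FiniteDimensional ℂ V := Module.rank_lt_aleph0_iff.mp hR
  have hid : IsCompactOperator (id : V → V) :=
    isCompactOperator_id_iff_finiteDimensional (𝕜 := ℂ).mpr hfin
  have h := (hid.comp_clm (R.codRestrict V fun x => ⟨x, rfl⟩)).clm_comp V.subtypeL
  exact h

theorem weakSchattenNorm_le {q C : ℝ} {A : H →L[ℂ] H}
    (h : ∀ n : ℕ, RankApprox n (C * ((n : ℝ) + 1) ^ (-(1 / q))) A) :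
    weakSchattenNorm q A ≤ ENNReal.ofReal C := by
  refine iSup_le fun n => ENNReal.ofReal_le_ofReal ?_
  have hpos : (0 : ℝ) < (n : ℝ) + 1 := by positivity
  calc ((n : ℝ) + 1) ^ (1 / q) * singularValue n A
      ≤ ((n : ℝ) + 1) ^ (1 / q) * (C * ((n : ℝ) + 1) ^ (-(1 / q))) := by
        gcongr
        exact (h n).singularValue_le
    _ = C := by
        rw [mul_left_comm, ← Real.rpow_add hpos, add_neg_cancel, Real.rpow_zero, mul_one]

theorem IsWeakSmall.isWeakBounded {α : ℝ} (hα : 0 ≤ α) {A : H →L[ℂ] H} (hA : IsWeakSmall α A) :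
    IsWeakBounded α A := by
  obtain ⟨n₀, h⟩ := hA 1 one_pos
  refine ⟨max 1 (‖A‖ * ((n₀ : ℝ) + 1) ^ α), by positivity, fun n => ?_⟩
  have hpos : (0 : ℝ) < (n : ℝ) + 1 := by positivity
  rcases le_or_gt n₀ n with hn | hn
  · refine (h n hn).mono le_rfl ?_
    gcongr
    exact le_max_left _ _
  · refine RankApprox.of_norm_le ?_
    calc ‖A‖ = ‖A‖ * ((n : ℝ) + 1) ^ α * ((n : ℝ) + 1) ^ (-α) := by
          rw [mul_assoc, ← Real.rpow_add hpos, add_neg_cancel, Real.rpow_zero, mul_one]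
      _ ≤ ‖A‖ * ((n₀ : ℝ) + 1) ^ α * ((n : ℝ) + 1) ^ (-α) := by gcongr
      _ ≤ _ := by
          gcongr
          exact le_max_right _ _

/-- Take for `F` a good approximant of rank `N`. For `n ≥ 2N`, an approximant `R` of `A` of rank `n
- N` yields `R - F` of rank at most `n`, and `n - N` is still at least half of `n`. For `n < 2N`,
the zero operator already suffices, since `‖A - F‖` is small on the scale of `N`. -/
theorem IsWeakSmall.exists_finiteRank {α : ℝ} (hα : 0 ≤ α) {A : H →L[ℂ] H}
    (hA : IsWeakSmall α A) {ε : ℝ} (hε : 0 < ε) :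
    ∃ F : H →L[ℂ] H, LinearMap.rank (F : H →ₗ[ℂ] H) < Cardinal.aleph0 ∧
      ∀ n : ℕ, RankApprox n (ε * ((n : ℝ) + 1) ^ (-α)) (A - F) := by
  obtain ⟨N, h⟩ := hA (ε / 2 ^ α) (by positivity)
  obtain ⟨F, hF, hAF⟩ := h N le_rfl
  have key : ∀ m n : ℕ, n + 1 ≤ 2 * (m + 1) →
      ε / 2 ^ α * ((m : ℝ) + 1) ^ (-α) ≤ ε * ((n : ℝ) + 1) ^ (-α) := fun m n hmn => by
    calc ε / 2 ^ α * ((m : ℝ) + 1) ^ (-α)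
        ≤ ε / 2 ^ α * (2 ^ α * ((n : ℝ) + 1) ^ (-α)) := by
          gcongr
          exact rpow_neg_le_of_le_two_mul hα (by positivity) (by exact_mod_cast hmn)
      _ = _ := by field_simp
  refine ⟨F, hF.trans_lt Cardinal.natCast_lt_aleph0, fun n => ?_⟩
  rcases le_or_gt (2 * N) n with hn | hn
  · obtain ⟨R, hR, hAR⟩ := h (n - N) (by omega)
    refine ⟨R - F, ?_, ?_⟩
    · rw [sub_eq_add_neg, ContinuousLinearMap.toLinearMap_add]
      refine (LinearMap.rank_add_le _ _).trans ?_
      have hneg : LinearMap.rank ((-F : H →L[ℂ] H) : H →ₗ[ℂ] H) ≤ N := by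
        rw [LinearMap.rank, ContinuousLinearMap.toLinearMap_neg, LinearMap.range_neg]
        exact hF
      refine (add_le_add hR hneg).trans ?_
      exact_mod_cast (by omega : n - N + N ≤ n)
    · rw [sub_sub_sub_cancel_right]
      exact hAR.trans (key _ _ (by omega))
  · exact RankApprox.of_norm_le (hAF.trans (key _ _ (by omega)))

theorem IsWeakSmall.mem_weakSchattenSep [CompleteSpace H] {q : ℝ} (hq : 0 < q) {A : H →L[ℂ] H}
    (hA : IsWeakSmall (1 / q) A) : A ∈ weakSchattenSep H q := by
  have hα : 0 ≤ 1 / q := by positivity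
  refine ⟨⟨?_, ?_⟩, fun ε hε => ?_⟩
  · choose F hF hAF using fun m : ℕ => hA.exists_finiteRank hα (ε := 1 / ((m : ℝ) + 1))
      (by positivity)
    -- The index `0` turns the weak estimate into an operator-norm estimate; `R m` has rank zero.
    choose R hR hAR using fun m => hAF m 0
    have hlim : Filter.Tendsto (fun m => F m + R m) Filter.atTop (nhds A) := by
      rw [tendsto_iff_norm_sub_tendsto_zero]
      refine squeeze_zero (fun _ => norm_nonneg _) (fun m => ?_)
        tendsto_one_div_add_atTop_nhds_zero_nat
      have := hAR m
      rw [norm_sub_rev, ← sub_sub]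
      simpa using this
    refine isCompactOperator_of_tendsto hlim (Filter.Eventually.of_forall fun m => ?_)
    refine IsCompactOperator.add (isCompactOperator_of_rank_lt_aleph0 (hF m))
      (isCompactOperator_of_rank_lt_aleph0 ((hR m).trans_lt Cardinal.natCast_lt_aleph0))
  · obtain ⟨C, -, h⟩ := hA.isWeakBounded hα
    exact (weakSchattenNorm_le h).trans_lt ENNReal.ofReal_lt_top
  · obtain ⟨δ, hδ, hδε⟩ := ENNReal.lt_iff_exists_real_btwn.mp hε
    have hδ0 : 0 < δ := by simpa using hδε.1
    obtain ⟨F, hF, hAF⟩ := hA.exists_finiteRank hα hδ0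
    exact ⟨F, hF, (weakSchattenNorm_le hAF).trans_lt hδε.2⟩

end RankApprox

/-! ### Algebra of multiplication operators and Fourier multipliers. -/

section Multipliers

open scoped ComplexConjugate

variable {d : ℕ}

theorem IsBoundedBorel.mul {f g : Rd d → ℂ} (hf : IsBoundedBorel f) (hg : IsBoundedBorel g) :
    IsBoundedBorel (fun x => f x * g x) := by
  obtain ⟨hfm, C, hC⟩ := hf
  obtain ⟨hgm, D, hD⟩ := hg
  refine ⟨hfm.mul hgm, C * D, fun x => ?_⟩
  rw [norm_mul]
  exact mul_le_mul (hC x) (hD x) (norm_nonneg _) ((norm_nonneg _).trans (hC x))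

theorem IsBoundedBorel.conj {f : Rd d → ℂ} (hf : IsBoundedBorel f) :
    IsBoundedBorel (fun x => conj (f x)) := by
  obtain ⟨hfm, C, hC⟩ := hf
  refine ⟨Complex.continuous_conj.measurable.comp hfm, C, fun x => ?_⟩
  rw [RCLike.norm_conj]
  exact hC x

theorem mulOp_congr {f g : Rd d → ℂ} (hf : IsBoundedBorel f) (hg : IsBoundedBorel g)
    (h : ∀ x, f x = g x) : mulOp f hf = mulOp g hg := by
  obtain rfl : f = g := funext h
  rfl

theorem mulOp_comp {f g : Rd d → ℂ} (hf : IsBoundedBorel f) (hg : IsBoundedBorel g) :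
    mulOp f hf ∘L mulOp g hg = mulOp (fun x => f x * g x) (hf.mul hg) := by
  ext1 u
  apply Lp.ext
  filter_upwards [mulOp_apply_ae f hf (mulOp g hg u), mulOp_apply_ae g hg u,
    mulOp_apply_ae _ (hf.mul hg) u] with x h1 h2 h3
  rw [ContinuousLinearMap.comp_apply, h1, h2, h3, mul_assoc]

theorem mulOp_const_add_sub {c : ℂ} {f g : Rd d → ℂ} (hf : IsBoundedBorel fun x => c + f x)
    (hg : IsBoundedBorel g) (hfg : IsBoundedBorel fun x => f x - g x) :
    mulOp (fun x => c + f x) hf =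
      c • ContinuousLinearMap.id ℂ (L2 d) + mulOp g hg + mulOp (fun x => f x - g x) hfg := by
  ext1 u
  apply Lp.ext
  filter_upwards [Lp.coeFn_add (c • u + mulOp g hg u) (mulOp _ hfg u),
    Lp.coeFn_add (c • u) (mulOp g hg u), Lp.coeFn_smul c u, mulOp_apply_ae _ hf u,
    mulOp_apply_ae g hg u, mulOp_apply_ae _ hfg u] with x h0 h1 h2 h3 h4 h5
  simp only [add_apply, smul_apply,
    ContinuousLinearMap.id_apply]
  rw [h0, Pi.add_apply, h1, Pi.add_apply, h2, h3, h4, h5, Pi.smul_apply, smul_eq_mul]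
  ring

theorem norm_mulOp_le {f : Rd d → ℂ} (hf : IsBoundedBorel f) {C : ℝ} (hC : 0 ≤ C)
    (h : ∀ x, ‖f x‖ ≤ C) : ‖mulOp f hf‖ ≤ C := by
  refine ContinuousLinearMap.opNorm_le_bound _ hC fun u => ?_
  refine Lp.norm_le_mul_norm_of_ae_le_mul ?_
  filter_upwards [mulOp_apply_ae f hf u] with x hx
  rw [hx, norm_mul]
  gcongr
  exact h x

theorem adjoint_mulOp {f : Rd d → ℂ} (hf : IsBoundedBorel f) :
    ContinuousLinearMap.adjoint (mulOp f hf) = mulOp (fun x => conj (f x)) hf.conj := by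
  symm
  rw [ContinuousLinearMap.eq_adjoint_iff]
  intro u v
  rw [L2.inner_def, L2.inner_def]
  apply integral_congr_ae
  filter_upwards [mulOp_apply_ae _ hf.conj u, mulOp_apply_ae f hf v] with x h1 h2
  simp only [h1, h2, RCLike.inner_apply, map_mul, RCLike.conj_conj]
  ring

theorem eq_of_fourier_ae_eq {u v : L2 d} (h : (𝓕 u : L2 d) =ᵐ[volume] (𝓕 v : L2 d)) : u = v :=
  (Lp.fourierTransformₗᵢ (Rd d) ℂ).injective (Lp.ext h)

theorem gradOp_comm {f g : Rd d → ℂ} (hf : IsBoundedBorel f) (hg : IsBoundedBorel g) :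
    gradOp f hf ∘L gradOp g hg = gradOp g hg ∘L gradOp f hf := by
  ext1 u
  apply eq_of_fourier_ae_eq
  filter_upwards [fourier_gradOp_ae f hf (gradOp g hg u), fourier_gradOp_ae g hg (gradOp f hf u),
    fourier_gradOp_ae f hf u, fourier_gradOp_ae g hg u] with x h1 h2 h3 h4
  rw [ContinuousLinearMap.comp_apply, ContinuousLinearMap.comp_apply, h1, h2, h3, h4]
  ring

theorem adjoint_gradOp {g : Rd d → ℂ} (hg : IsBoundedBorel g) :
    ContinuousLinearMap.adjoint (gradOp g hg) = gradOp (fun x => conj (g x)) hg.conj := by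
  symm
  rw [ContinuousLinearMap.eq_adjoint_iff]
  intro u v
  rw [← Lp.inner_fourier_eq, ← Lp.inner_fourier_eq u]
  rw [L2.inner_def, L2.inner_def]
  apply integral_congr_ae
  filter_upwards [fourier_gradOp_ae _ hg.conj u, fourier_gradOp_ae g hg v] with x h1 h2
  simp only [h1, h2, RCLike.inner_apply, map_mul, RCLike.conj_conj]
  ring

theorem gradOp_congr {f g : Rd d → ℂ} (hf : IsBoundedBorel f) (hg : IsBoundedBorel g)
    (h : ∀ x, f x = g x) : gradOp f hf = gradOp g hg := by
  obtain rfl : f = g := funext h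
  rfl

theorem adjoint_besselOp {p : ℝ} (hp : 0 < p) :
    ContinuousLinearMap.adjoint (besselOp d p hp) = besselOp d p hp := by
  rw [besselOp, adjoint_gradOp]
  exact gradOp_congr _ _ fun x => Complex.conj_ofReal _

end Multipliers

/-! ### Fourier series on a cube, transported from the torus. -/

section FourierSeries

open scoped ComplexConjugate

/-- The normalized Haar measure on the unit circle, as in the theory of `UnitAddTorus`. -/
local instance unitAddCircleMeasureSpace : MeasureSpace UnitAddCircle :=
  ⟨AddCircle.haarAddCircle⟩

local instance : Measure.IsAddHaarMeasure (volume : Measure UnitAddCircle) :=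
  inferInstanceAs (Measure.IsAddHaarMeasure AddCircle.haarAddCircle)

local instance : IsProbabilityMeasure (volume : Measure UnitAddCircle) :=
  inferInstanceAs (IsProbabilityMeasure AddCircle.haarAddCircle)

variable {d : ℕ}

/-- The half-open cube of side `L` centered at the origin. -/
def cube (d : ℕ) (L : ℝ) : Set (Rd d) := {x | ∀ i, x i ∈ Set.Ioc (-(L / 2)) (L / 2)}

/-- The point `k / L` of the lattice dual to the cube of side `L`. -/
def freq (L : ℝ) (k : Fin d → ℤ) : Rd d := WithLp.toLp 2 fun i => (k i : ℝ) / L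

/-- The character `x ↦ exp (2πi⟨κ, x⟩)`. -/
def character (κ x : Rd d) : ℂ := (Real.fourierChar (inner ℝ κ x) : ℂ)

theorem norm_character (κ x : Rd d) : ‖character κ x‖ = 1 := Circle.norm_coe _

theorem continuous_character (κ : Rd d) : Continuous (character κ) := by
  unfold character
  exact continuous_subtype_val.comp (Real.continuous_fourierChar.comp (by fun_prop))

theorem measurableSet_cube (L : ℝ) : MeasurableSet (cube d L) := by
  have : cube d L = ⋂ i, {x : Rd d | x i ∈ Set.Ioc (-(L / 2)) (L / 2)} := by
    ext x; simp [cube]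
  rw [this]
  refine MeasurableSet.iInter fun i => ?_
  have hm : Measurable fun x : Rd d => x i := by fun_prop
  exact hm measurableSet_Ioc

/-- The parametrization of the cube of side `L` by the torus. -/
def torusParam (d : ℕ) (L : ℝ) (θ : UnitAddTorus (Fin d)) : Rd d :=
  L • WithLp.toLp 2 (UnitAddTorus.measurableEquivPiIoc (fun _ => -(1 / 2)) θ).1

/-- The factor `L^{-d}` appears because the torus carries a probability measure. -/
theorem measurePreserving_torusParam {L : ℝ} (hL : 0 < L) :
    MeasurePreserving (torusParam d L) volume
      (ENNReal.ofReal (L ^ d)⁻¹ • volume.restrict (cube d L)) := by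
  have h1 := UnitAddTorus.measurePreserving_equivPiIoc (d := Fin d) (fun _ => -(1 / 2))
  have hms : MeasurableSet {x : Fin d → ℝ | ∀ i, x i ∈ Set.Ioc (-(1 / 2) : ℝ) (-(1 / 2) + 1)} :=
    MeasurableSet.univ_pi' fun i => measurableSet_Ioc
  have h2 : MeasurePreserving
      (Subtype.val : {x : Fin d → ℝ // ∀ i, x i ∈ Set.Ioc (-(1 / 2) : ℝ) (-(1 / 2) + 1)} → _)
      (Measure.comap Subtype.val volume)
      (volume.restrict {x : Fin d → ℝ | ∀ i, x i ∈ Set.Ioc (-(1 / 2) : ℝ) (-(1 / 2) + 1)}) :=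
    ⟨measurable_subtype_coe, map_comap_subtype_coe hms volume⟩
  have h3 : MeasurePreserving (WithLp.toLp 2 : (Fin d → ℝ) → Rd d)
      (volume.restrict {x : Fin d → ℝ | ∀ i, x i ∈ Set.Ioc (-(1 / 2) : ℝ) (-(1 / 2) + 1)})
      (volume.restrict (cube d 1)) := by
    have := (PiLp.volume_preserving_toLp (Fin d)).restrict_preimage (measurableSet_cube (d := d) 1)
    have hset : {x : Fin d → ℝ | ∀ i, x i ∈ Set.Ioc (-(1 / 2) : ℝ) (-(1 / 2) + 1)} =
        WithLp.toLp 2 ⁻¹' cube d 1 := by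
      have h : (-(1 / 2) + 1 : ℝ) = 1 / 2 := by norm_num
      rw [h]
      rfl
    rw [hset]
    exact this
  have h4 : MeasurePreserving (fun x : Rd d => L • x) (volume.restrict (cube d 1))
      (ENNReal.ofReal (L ^ d)⁻¹ • volume.restrict (cube d L)) := by
    refine ⟨measurable_const_smul L, ?_⟩
    have hpre : (fun x : Rd d => L • x) ⁻¹' cube d L = cube d 1 := by
      ext x
      simp only [cube, Set.mem_preimage, Set.mem_ofPred_eq, PiLp.smul_apply, smul_eq_mul, Set.mem_Ioc]
      refine forall_congr' fun i => ?_
      constructor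
      · rintro ⟨h, h'⟩
        constructor <;> nlinarith
      · rintro ⟨h, h'⟩
        constructor <;> nlinarith
    rw [← hpre, ← Measure.restrict_map (measurable_const_smul L) (measurableSet_cube L),
      Measure.map_addHaar_smul volume hL.ne', Measure.restrict_smul]
    simp [abs_of_pos hL]
  exact h4.comp (h3.comp (h2.comp h1))

theorem character_torusParam {L : ℝ} (hL : 0 < L) (k : Fin d → ℤ) (θ : UnitAddTorus (Fin d)) :
    character (freq L k) (torusParam d L θ) = UnitAddTorus.mFourier k θ := by
  set r := UnitAddTorus.measurableEquivPiIoc (fun _ : Fin d => -(1 / 2)) θ with hr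
  have hθ : θ = fun i => (r.1 i : UnitAddCircle) := by
    rw [← UnitAddTorus.coe_symm_measurableEquivPiIoc_apply, hr, MeasurableEquiv.symm_apply_apply]
  have hin : inner ℝ (freq L k) (torusParam d L θ) = ∑ i, (k i : ℝ) * r.1 i := by
    simp only [torusParam, freq, PiLp.inner_apply, PiLp.smul_apply, smul_eq_mul]
    refine Finset.sum_congr rfl fun i _ => ?_
    simp only [RCLike.inner_apply, conj_trivial]
    rw [← hr]
    field_simp
  rw [character, hin, Real.fourierChar_apply, UnitAddTorus.mFourier]
  conv_rhs => rw [hθ]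
  simp only [ContinuousMap.coe_mk, fourier_coe_apply]
  rw [← Complex.exp_sum]
  congr 1
  push_cast
  rw [Finset.mul_sum, Finset.sum_mul]
  refine Finset.sum_congr rfl fun i _ => ?_
  simp
  ring

/-- The normalized exponentials on the cube. -/
theorem memLp_cubeExp (L : ℝ) (k : Fin d → ℤ) :
    MemLp ((cube d L).indicator fun x => ((Real.sqrt (L ^ d)⁻¹ : ℝ) : ℂ) * character (freq L k) x) 2
      (volume : Measure (Rd d)) := by
  rw [memLp_indicator_iff_restrict (measurableSet_cube L)]
  have hfin : volume (cube d L) ≠ ⊤ := by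
    refine (Bornology.IsBounded.measure_lt_top ?_).ne
    refine (Metric.isBounded_closedBall (x := (0 : Rd d)) (r := Real.sqrt (∑ _i : Fin d, (L / 2) ^ 2))).subset ?_
    intro x hx
    rw [mem_closedBall_zero_iff, EuclideanSpace.norm_eq]
    refine Real.sqrt_le_sqrt (Finset.sum_le_sum fun i _ => ?_)
    rw [Real.norm_eq_abs, sq_abs]
    have := hx i
    exact sq_le_sq' (by linarith [this.1]) this.2
  have : IsFiniteMeasure (volume.restrict (cube d L)) := ⟨by simpa using hfin.lt_top⟩
  refine MemLp.of_bound ?_ (Real.sqrt (L ^ d)⁻¹) (Filter.Eventually.of_forall fun x => ?_)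
  · exact (continuous_const.mul (continuous_character _)).aestronglyMeasurable
  · rw [norm_mul, norm_character, mul_one, Complex.norm_real, Real.norm_of_nonneg (Real.sqrt_nonneg _)]

/-- The normalized exponentials on the cube of side `L`, as elements of `L_2(ℝ^d)`. -/
def cubeExp (L : ℝ) (k : Fin d → ℤ) : L2 d := (memLp_cubeExp L k).toLp

theorem integral_torusParam {L : ℝ} (hL : 0 < L) {F : Rd d → ℂ}
    (hF : AEStronglyMeasurable F (volume : Measure (Rd d))) :
    ∫ θ, F (torusParam d L θ) = ((L ^ d)⁻¹ : ℝ) • ∫ x in cube d L, F x := by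
  have hmp := measurePreserving_torusParam (d := d) hL
  have hF' : AEStronglyMeasurable F (Measure.map (torusParam d L) volume) := by
    rw [hmp.map_eq]
    exact hF.restrict.smul_measure _
  rw [← integral_map hmp.measurable.aemeasurable hF', hmp.map_eq, integral_smul_measure,
    ENNReal.toReal_ofReal (by positivity)]

theorem inner_cubeExp {L : ℝ} (k : Fin d → ℤ) (v : L2 d) :
    inner ℂ (cubeExp L k) v = ((Real.sqrt (L ^ d)⁻¹ : ℝ) : ℂ) *
      ∫ x in cube d L, conj (character (freq L k) x) * v x := by
  rw [L2.inner_def, ← integral_const_mul, ← integral_indicator (measurableSet_cube L)]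
  apply integral_congr_ae
  filter_upwards [(memLp_cubeExp L k).coeFn_toLp] with x hx
  rw [cubeExp, hx, RCLike.inner_apply]
  by_cases h : x ∈ cube d L
  · rw [Set.indicator_of_mem h, Set.indicator_of_mem h, map_mul, Complex.conj_ofReal]
    ring
  · rw [Set.indicator_of_notMem h, Set.indicator_of_notMem h, map_zero, mul_zero]

theorem orthonormal_cubeExp {L : ℝ} (hL : 0 < L) : Orthonormal ℂ (cubeExp (d := d) L) := by
  rw [orthonormal_iff_ite]
  intro k l
  have h := orthonormal_iff_ite.mp (UnitAddTorus.orthonormal_mFourier (d := Fin d)) k l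
  rw [← h, inner_cubeExp]
  have h1 : ∫ x in cube d L, conj (character (freq L k) x) * (cubeExp L l : L2 d) x =
      ((Real.sqrt (L ^ d)⁻¹ : ℝ) : ℂ) *
        ∫ x in cube d L, conj (character (freq L k) x) * character (freq L l) x := by
    rw [← integral_const_mul]
    refine setIntegral_congr_ae (measurableSet_cube L) ?_
    filter_upwards [(memLp_cubeExp L l).coeFn_toLp] with x hx hxc
    rw [cubeExp, hx, Set.indicator_of_mem hxc]
    ring
  rw [h1, ← mul_assoc, ← Complex.ofReal_mul, Real.mul_self_sqrt (by positivity),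
    ContinuousMap.inner_toLp, ← Complex.real_smul, ← integral_torusParam hL]
  · simp only [character_torusParam hL]
    refine integral_congr_ae (Filter.Eventually.of_forall fun θ => ?_)
    simp [mul_comm]
  · exact ((Complex.continuous_conj.comp (continuous_character _)).mul
      (continuous_character _)).aestronglyMeasurable

/-- Parseval on the torus. The exponentials are complete only among functions supported in the cube,
hence the hypothesis on `v`. -/
theorem hasSum_sq_inner_cubeExp {L : ℝ} (hL : 0 < L) (v : L2 d)
    (hv : ∀ᵐ x, x ∉ cube d L → v x = 0) :
    HasSum (fun k => ‖inner ℂ (cubeExp L k) v‖ ^ 2) (‖v‖ ^ 2) := by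
  have hmp := measurePreserving_torusParam (d := d) hL
  have hmem : MemLp (fun θ => v (torusParam d L θ)) 2 volume := by
    have h1 : MemLp v 2 (ENNReal.ofReal (L ^ d)⁻¹ • volume.restrict (cube d L)) :=
      ((Lp.memLp v).restrict _).smul_measure ENNReal.ofReal_ne_top
    exact h1.comp_measurePreserving hmp
  have hc : (0 : ℝ) < (L ^ d)⁻¹ := by positivity
  have hcoeff : ∀ k, ‖UnitAddTorus.mFourierCoeff (hmem.toLp : _ → ℂ) k‖ ^ 2 =
      (L ^ d)⁻¹ * ‖inner ℂ (cubeExp L k) v‖ ^ 2 := fun k => by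
    have : UnitAddTorus.mFourierCoeff (hmem.toLp : _ → ℂ) k =
        ((L ^ d)⁻¹ : ℝ) • ∫ x in cube d L, conj (character (freq L k) x) * v x := by
      rw [← integral_torusParam hL, UnitAddTorus.mFourierCoeff]
      · apply integral_congr_ae
        filter_upwards [hmem.coeFn_toLp] with θ hθ
        rw [hθ, smul_eq_mul, UnitAddTorus.mFourier_neg, character_torusParam hL]
      · exact (Complex.continuous_conj.comp (continuous_character _)).aestronglyMeasurable.mul
          (Lp.aestronglyMeasurable v)
    rw [this, inner_cubeExp, norm_smul, norm_mul, mul_pow, mul_pow, Complex.norm_real,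
      Real.norm_of_nonneg hc.le, Real.norm_of_nonneg (Real.sqrt_nonneg _), Real.sq_sqrt hc.le]
    ring
  have hint : ∫ θ, ‖(hmem.toLp : _ → ℂ) θ‖ ^ 2 = (L ^ d)⁻¹ * ‖v‖ ^ 2 := by
    have e1 : ∫ θ, ((‖(hmem.toLp : _ → ℂ) θ‖ ^ 2 : ℝ) : ℂ) =
        ((L ^ d)⁻¹ : ℝ) • ∫ x in cube d L, ((‖v x‖ ^ 2 : ℝ) : ℂ) := by
      rw [← integral_torusParam hL (F := fun x => ((‖v x‖ ^ 2 : ℝ) : ℂ))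
        (Complex.continuous_ofReal.comp_aestronglyMeasurable
        ((Lp.aestronglyMeasurable v).norm.pow 2))]
      apply integral_congr_ae
      filter_upwards [hmem.coeFn_toLp] with θ hθ
      rw [hθ]
    have e2 : ∫ x in cube d L, ‖v x‖ ^ 2 = ‖v‖ ^ 2 := by
      rw [← integral_indicator (measurableSet_cube L), ← inner_self_eq_norm_sq (𝕜 := ℂ) v,
        L2.inner_def, ← integral_re (L2.integrable_inner v v)]
      apply integral_congr_ae
      filter_upwards [hv] with x hx
      by_cases h : x ∈ cube d L
      · rw [Set.indicator_of_mem h, inner_self_eq_norm_sq]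
      · rw [Set.indicator_of_notMem h, hx h]
        simp
    rw [integral_complex_ofReal, integral_complex_ofReal, e2, Complex.real_smul] at e1
    exact_mod_cast e1
  have hsum := UnitAddTorus.hasSum_sq_mFourierCoeff hmem.toLp
  rw [hint] at hsum
  simp only [hcoeff] at hsum
  exact (hasSum_mul_left_iff hc.ne').mp hsum

end FourierSeries

/-! ### Lattice sums and a Schur test. -/

section Schur

variable {d : ℕ}

/-- The weight `(1 + |x|)^{-(d+1)}`. -/
def decay (x : Rd d) : ℝ := ((1 + ‖x‖) ^ (d + 1))⁻¹

theorem decay_pos (x : Rd d) : 0 < decay x := by unfold decay; positivity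

theorem decay_le_one (x : Rd d) : decay x ≤ 1 := by
  apply inv_le_one_of_one_le₀
  exact one_le_pow₀ (by linarith [norm_nonneg x])

theorem continuous_decay : Continuous (decay (d := d)) := by
  unfold decay
  exact Continuous.inv₀ (by fun_prop) fun x => by positivity

theorem integrable_decay : Integrable (decay (d := d)) := by
  have := integrable_one_add_norm (E := Rd d) (μ := volume) (r := (d + 1 : ℕ)) (by simp)
  refine this.congr (Filter.Eventually.of_forall fun x => ?_)
  change (1 + ‖x‖) ^ (-((d + 1 : ℕ) : ℝ)) = _
  rw [decay, Real.rpow_neg (by positivity), Real.rpow_natCast]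

/-- Peetre's inequality: a weight can be recentred at the price of a power of the displacement. -/
theorem one_add_norm_le_mul (x y : Rd d) : 1 + ‖x‖ ≤ (1 + ‖x + y‖) * (1 + ‖y‖) := by
  have : ‖x‖ ≤ ‖x + y‖ + ‖y‖ := by simpa using norm_sub_le (x + y) y
  nlinarith [norm_nonneg (x + y), norm_nonneg y]

theorem freq_sub (L : ℝ) (k l : Fin d → ℤ) : freq L (k - l) = freq L k - freq L l := by
  ext i
  simp [freq, sub_div]

theorem freq_eq_smul (L : ℝ) (k : Fin d → ℤ) : freq L k = L⁻¹ • freq 1 k := by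
  ext i
  simp [freq, div_eq_inv_mul]

theorem abs_le_norm_freq {L : ℝ} (hL : 0 < L) (k : Fin d → ℤ) (i : Fin d) :
    |(k i : ℝ)| / L ≤ ‖freq L k‖ := by
  have := PiLp.norm_apply_le (freq L k) i
  simpa [freq, abs_of_pos hL] using this

/-- Comparison with the sum of `|x|^{-(d+1)}` over a lattice of rank `d`, convergent because the
exponent exceeds `d`. -/
theorem summable_decay_freq {L : ℝ} (hL : 0 < L) :
    Summable fun k : Fin d → ℤ => decay (freq L k) := by
  set b := (EuclideanSpace.basisFun (Fin d) ℝ).toBasis with hb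
  set Λ := (Submodule.span ℤ (Set.range b)) with hΛ
  have hrank : Module.finrank ℤ Λ = d := by
    rw [ZLattice.rank ℝ Λ]
    simp
  have hs := ZLattice.summable_norm_rpow Λ (-(d + 1 : ℕ) : ℝ) (by rw [hrank]; push_cast; linarith)
  have hmem : ∀ k : Fin d → ℤ, freq 1 k ∈ Λ := fun k => by
    have : freq 1 k = ∑ i, k i • b i := by
      ext j
      simp [freq, hb, Finset.sum_apply, Pi.single_apply]
    rw [this]
    exact Submodule.sum_mem _ fun i _ =>
      Submodule.smul_mem _ _ (Submodule.subset_span ⟨i, rfl⟩)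
  have hinj : Function.Injective fun k : Fin d → ℤ => (⟨freq 1 k, hmem k⟩ : Λ) := by
    intro k l h
    ext i
    have := congrArg (fun x : Λ => (x : Rd d) i) h
    simpa [freq] using this
  have hs' := (hs.comp_injective hinj).mul_left (L⁻¹ ^ (-(d + 1 : ℕ) : ℝ))
  refine Summable.of_norm_bounded_eventually hs' ?_
  -- The comparison can fail only at the origin, where the negative real power of `0` takes its
  -- default value `0`.
  refine (Set.finite_singleton (0 : Fin d → ℤ)).subset fun k hk => ?_
  by_contra h0
  apply hk
  have hne : freq 1 k ≠ 0 := fun h => h0 (by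
    ext i
    have := congrArg (fun x : Rd d => x i) h
    simpa [freq] using this)
  have hpos : 0 < ‖freq 1 k‖ := norm_pos_iff.mpr hne
  change ‖decay (freq L k)‖ ≤ L⁻¹ ^ (-(d + 1 : ℕ) : ℝ) * ‖freq 1 k‖ ^ (-(d + 1 : ℕ) : ℝ)
  rw [Real.norm_of_nonneg (decay_pos _).le, freq_eq_smul, decay, norm_smul,
    Real.norm_of_nonneg (by positivity), ← Real.mul_rpow (by positivity) hpos.le, Real.rpow_neg (by positivity), Real.rpow_natCast]
  gcongr
  linarith

theorem decay_le_mul (x y : Rd d) : decay (x + y) ≤ (1 + ‖y‖) ^ (d + 1) * decay x := by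
  unfold decay
  rw [← div_eq_mul_inv, inv_eq_one_div, div_le_div_iff₀ (by positivity) (by positivity), one_mul,
    ← mul_pow, mul_comm]
  gcongr
  exact one_add_norm_le_mul x y

/-- Uniformity in `ξ`: round `ξ` to a lattice point `m`. The displacement is bounded, so Peetre's
inequality compares the sum with the one centred at `m`, and translation invariance of the lattice
finishes. -/
theorem exists_sum_decay_le {L : ℝ} (hL : 0 < L) :
    ∃ S : ℝ, 0 ≤ S ∧ ∀ (K : Finset (Fin d → ℤ)) (ξ : Rd d),
      ∑ k ∈ K, decay (ξ - freq L k) ≤ S := by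
  set B : ℝ := (1 + ∑ _i : Fin d, 1 / L) ^ (d + 1) with hB
  have hB0 : 0 ≤ B := by positivity
  refine ⟨B * ∑' k : Fin d → ℤ, decay (freq L k), mul_nonneg hB0 (tsum_nonneg fun k =>
    (decay_pos _).le), fun K ξ => ?_⟩
  set m : Fin d → ℤ := fun i => round (L * ξ i) with hm
  have hmξ : ‖ξ - freq L m‖ ≤ ∑ _i : Fin d, 1 / L := by
    rw [← (EuclideanSpace.basisFun (Fin d) ℝ).sum_repr (ξ - freq L m)]
    refine norm_sum_le_of_le _ fun i _ => ?_
    rw [norm_smul, (EuclideanSpace.basisFun (Fin d) ℝ).norm_eq_one, mul_one, Real.norm_eq_abs]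
    have h1 : (EuclideanSpace.basisFun (Fin d) ℝ).repr (ξ - freq L m) i =
        (L * ξ i - round (L * ξ i)) / L := by
      simp [freq, hm]
      field_simp
    rw [h1, abs_div, abs_of_pos hL]
    gcongr
    exact (abs_sub_round _).trans (by norm_num)
  calc ∑ k ∈ K, decay (ξ - freq L k)
      ≤ ∑ k ∈ K, B * decay (freq L (m - k)) := by
        refine Finset.sum_le_sum fun k _ => ?_
        have := decay_le_mul (freq L (m - k)) (ξ - freq L m)
        rw [freq_sub] at this ⊢
        have e : freq L m - freq L k + (ξ - freq L m) = ξ - freq L k := by abel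
        rw [e] at this
        refine this.trans (mul_le_mul_of_nonneg_right ?_ (decay_pos _).le)
        rw [hB]
        gcongr
    _ = B * ∑ k ∈ K, decay (freq L (m - k)) := by rw [Finset.mul_sum]
    _ ≤ B * ∑' k : Fin d → ℤ, decay (freq L k) := by
        gcongr
        rw [← Finset.sum_image (g := fun k => m - k) (f := fun k => decay (freq L k))
          (fun _ _ _ _ h => sub_right_injective h)]
        exact (summable_decay_freq hL).sum_le_tsum _ fun k _ => (decay_pos _).le

/-- Cauchy–Schwarz for the weight `φ`, from the discriminant of `t ↦ ∫ φ (g - t)²`, which is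
nonnegative for all `t`. -/
theorem sq_integral_mul_le {X : Type*} [MeasurableSpace X] {μ : Measure X} {φ g : X → ℝ}
    (hφ0 : ∀ x, 0 ≤ φ x) (hφ : Integrable φ μ) (h1 : Integrable (fun x => φ x * g x) μ)
    (h2 : Integrable (fun x => φ x * g x ^ 2) μ) :
    (∫ x, φ x * g x ∂μ) ^ 2 ≤ (∫ x, φ x ∂μ) * ∫ x, φ x * g x ^ 2 ∂μ := by
  have key : ∀ t : ℝ, 0 ≤ (∫ x, φ x ∂μ) * (t * t) + (-2 * ∫ x, φ x * g x ∂μ) * t +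
      ∫ x, φ x * g x ^ 2 ∂μ := fun t => by
    have : 0 ≤ ∫ x, φ x * (g x - t) ^ 2 ∂μ :=
      integral_nonneg fun x => mul_nonneg (hφ0 x) (sq_nonneg _)
    have e : ∫ x, φ x * (g x - t) ^ 2 ∂μ =
        ∫ x, (φ x * (t * t) + (φ x * g x) * (-2 * t)) + φ x * g x ^ 2 ∂μ := by
      congr 1
      ext x
      ring
    have i1 := hφ.mul_const (t * t)
    have i2 := h1.mul_const (-2 * t)
    have i12 : Integrable (fun x => φ x * (t * t) + φ x * g x * (-2 * t)) μ := i1.add i2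
    rw [e, integral_add i12 h2, integral_add i1 i2, integral_mul_const,
      integral_mul_const] at this
    linarith
  have := discrim_le_zero key
  rw [discrim] at this
  nlinarith

theorem integrable_sq_norm (u : L2 d) : Integrable fun x => ‖u x‖ ^ 2 :=
  (Lp.memLp u).integrable_norm_pow (by norm_num)

theorem integral_sq_norm (u : L2 d) : ∫ x, ‖u x‖ ^ 2 = ‖u‖ ^ 2 := by
  rw [← inner_self_eq_norm_sq (𝕜 := ℂ) u, L2.inner_def, ← integral_re (L2.integrable_inner u u)]
  apply integral_congr_ae
  filter_upwards with x
  rw [inner_self_eq_norm_sq]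

/-- Schur test. Plancherel and weighted Cauchy–Schwarz bound each coefficient by an integral of `|𝓕
u|²` against a bump centred at `freq L k`; the bumps have a uniformly bounded sum, so the constant
is independent of `K` and of its size. -/
theorem sum_sq_inner_le_of_fourier_decay {L : ℝ} (hL : 0 < L) :
    ∃ S : ℝ, 0 ≤ S ∧ ∀ (v : (Fin d → ℤ) → L2 d) (δ : ℝ) (K : Finset (Fin d → ℤ)), 0 ≤ δ →
      (∀ k ∈ K, ∀ᵐ ξ, ‖(𝓕 (v k) : L2 d) ξ‖ ≤ δ * decay (ξ - freq L k)) →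
      ∀ u : L2 d, ∑ k ∈ K, ‖inner ℂ (v k) u‖ ^ 2 ≤ (S * δ * ‖u‖) ^ 2 := by
  obtain ⟨S, hS, hsum⟩ := exists_sum_decay_le (d := d) hL
  set W : ℝ := ∫ x : Rd d, decay x with hW
  have hW0 : 0 ≤ W := integral_nonneg fun x => (decay_pos x).le
  refine ⟨Real.sqrt (W * S), Real.sqrt_nonneg _, fun v δ K hδ hv u => ?_⟩
  set g : Rd d → ℝ := fun ξ => ‖(𝓕 u : L2 d) ξ‖ with hg
  have hgm : AEStronglyMeasurable g (volume : Measure (Rd d)) :=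
    (Lp.aestronglyMeasurable (𝓕 u : L2 d)).norm
  have hg2 : Integrable fun ξ => g ξ ^ 2 := integrable_sq_norm _
  have hφc : ∀ k, Continuous fun ξ : Rd d => decay (ξ - freq L k) := fun k =>
    continuous_decay.comp (continuous_sub_right _)
  have hφ : ∀ k, Integrable fun ξ : Rd d => decay (ξ - freq L k) := fun k =>
    integrable_decay.comp_sub_right _
  have hφ2 : ∀ k, Integrable fun ξ => decay (ξ - freq L k) * g ξ ^ 2 := fun k => by
    refine hg2.mono' ((hφc k).aestronglyMeasurable.mul (hgm.pow 2))
      (Filter.Eventually.of_forall fun ξ => ?_)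
    rw [Real.norm_of_nonneg (mul_nonneg (decay_pos _).le (sq_nonneg _))]
    exact mul_le_of_le_one_left (sq_nonneg _) (decay_le_one _)
  have hφ1 : ∀ k, Integrable fun ξ => decay (ξ - freq L k) * g ξ := fun k => by
    refine ((hφ k).add (hφ2 k)).mono' ((hφc k).aestronglyMeasurable.mul hgm)
      (Filter.Eventually.of_forall fun ξ => ?_)
    rw [Real.norm_of_nonneg (mul_nonneg (decay_pos _).le (norm_nonneg _))]
    change _ ≤ decay (ξ - freq L k) + decay (ξ - freq L k) * g ξ ^ 2
    nlinarith [decay_pos (ξ - freq L k), sq_nonneg (g ξ - 1), sq_nonneg (g ξ)]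
  have hterm : ∀ k ∈ K, ‖inner ℂ (v k) u‖ ^ 2 ≤
      δ ^ 2 * W * ∫ ξ, decay (ξ - freq L k) * g ξ ^ 2 := fun k hk => by
    have h1 : ‖inner ℂ (v k) u‖ ≤ δ * ∫ ξ, decay (ξ - freq L k) * g ξ := by
      rw [← Lp.inner_fourier_eq, L2.inner_def, ← integral_const_mul]
      refine norm_integral_le_of_norm_le ((hφ1 k).const_mul δ) ?_
      filter_upwards [hv k hk] with ξ hξ
      rw [← mul_assoc]
      exact (norm_inner_le_norm _ _).trans (by gcongr)
    have h2 := sq_integral_mul_le (fun ξ => (decay_pos (ξ - freq L k)).le) (hφ k) (hφ1 k) (hφ2 k)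
    have hWk : ∫ ξ, decay (ξ - freq L k) = W := integral_sub_right_eq_self decay (freq L k)
    rw [hWk] at h2
    calc ‖inner ℂ (v k) u‖ ^ 2 ≤ (δ * ∫ ξ, decay (ξ - freq L k) * g ξ) ^ 2 := by gcongr
      _ = δ ^ 2 * (∫ ξ, decay (ξ - freq L k) * g ξ) ^ 2 := by ring
      _ ≤ δ ^ 2 * (W * ∫ ξ, decay (ξ - freq L k) * g ξ ^ 2) := by gcongr
      _ = _ := by ring
  have hint : ∑ k ∈ K, ∫ ξ, decay (ξ - freq L k) * g ξ ^ 2 ≤ S * ‖u‖ ^ 2 := by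
    rw [← integral_finsetSum _ fun k _ => hφ2 k, ← Lp.norm_fourier_eq u, ← integral_sq_norm,
      ← integral_const_mul]
    refine integral_mono (integrable_finsetSum _ fun k _ => hφ2 k) (hg2.const_mul S) fun ξ => ?_
    change ∑ k ∈ K, decay (ξ - freq L k) * g ξ ^ 2 ≤ S * g ξ ^ 2
    rw [← Finset.sum_mul]
    gcongr
    exact hsum K ξ
  calc ∑ k ∈ K, ‖inner ℂ (v k) u‖ ^ 2
      ≤ ∑ k ∈ K, δ ^ 2 * W * ∫ ξ, decay (ξ - freq L k) * g ξ ^ 2 := Finset.sum_le_sum hterm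
    _ = δ ^ 2 * W * ∑ k ∈ K, ∫ ξ, decay (ξ - freq L k) * g ξ ^ 2 := by rw [Finset.mul_sum]
    _ ≤ δ ^ 2 * W * (S * ‖u‖ ^ 2) := by gcongr
    _ = (Real.sqrt (W * S) * δ * ‖u‖) ^ 2 := by
        rw [mul_pow, mul_pow, Real.sq_sqrt (mul_nonneg hW0 hS)]
        ring

end Schur

/-! ### From decay of coefficients to singular values. -/

section Counting

variable {d : ℕ}

theorem norm_sub_sum_inner_sq {H ι : Type*} [NormedAddCommGroup H] [InnerProductSpace ℂ H]
    {b : ι → H} (hb : Orthonormal ℂ b) (s : Finset ι) (v : H) :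
    ‖v - ∑ k ∈ s, inner ℂ (b k) v • b k‖ ^ 2 = ‖v‖ ^ 2 - ∑ k ∈ s, ‖inner ℂ (b k) v‖ ^ 2 := by
  have h1 : RCLike.re (inner ℂ v (∑ k ∈ s, inner ℂ (b k) v • b k)) =
      ∑ k ∈ s, ‖inner ℂ (b k) v‖ ^ 2 := by
    rw [inner_sum, map_sum]
    refine Finset.sum_congr rfl fun k _ => ?_
    rw [inner_smul_right, inner_mul_symm_re_eq_norm, norm_mul, norm_inner_symm v, sq]
  have h2 : ‖∑ k ∈ s, inner ℂ (b k) v • b k‖ ^ 2 = ∑ k ∈ s, ‖inner ℂ (b k) v‖ ^ 2 := by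
    rw [← inner_self_eq_norm_sq (𝕜 := ℂ), hb.inner_sum, map_sum]
    refine Finset.sum_congr rfl fun k _ => ?_
    rw [RCLike.conj_mul]
    norm_cast
  rw [norm_sub_sq (𝕜 := ℂ), h1, h2]
  ring

/-- Projecting onto the span of the `b k`, `k ∈ s`, leaves a remainder whose squared norm is, by
Parseval on the range of `A`, the limit of the finite sums over indices outside `s`. -/
theorem rankApprox_of_forall_sum_le {H ι : Type*} [NormedAddCommGroup H] [InnerProductSpace ℂ H]
    {b : ι → H} (hb : Orthonormal ℂ b) {A : H →L[ℂ] H}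
    (hA : ∀ u, HasSum (fun k => ‖inner ℂ (b k) (A u)‖ ^ 2) (‖A u‖ ^ 2)) (s : Finset ι) {c : ℝ}
    (hc : 0 ≤ c)
    (h : ∀ (u : H) (K : Finset ι), Disjoint K s →
      ∑ k ∈ K, ‖inner ℂ (b k) (A u)‖ ^ 2 ≤ (c * ‖u‖) ^ 2) :
    RankApprox s.card c A := by
  classical
  set P : H →L[ℂ] H := ∑ k ∈ s, (innerSL ℂ (b k)).smulRight (b k) with hP
  have hPv : ∀ v, P v = ∑ k ∈ s, inner ℂ (b k) v • b k := fun v => by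
    simp [hP]
  refine ⟨P ∘L A, ?_, ?_⟩
  · rw [ContinuousLinearMap.toLinearMap_comp]
    refine (LinearMap.rank_comp_le_left _ _).trans ?_
    have hle : LinearMap.range (P : H →ₗ[ℂ] H) ≤
        Submodule.span ℂ ((s.image b : Finset H) : Set H) := by
      rintro _ ⟨v, rfl⟩
      rw [ContinuousLinearMap.coe_coe, hPv]
      exact Submodule.sum_mem _ fun k hk => Submodule.smul_mem _ _
        (Submodule.subset_span (by simpa using ⟨k, hk, rfl⟩))
    refine (Submodule.rank_mono hle).trans ((rank_span_finset_le _).trans ?_)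
    exact_mod_cast Finset.card_image_le
  · refine ContinuousLinearMap.opNorm_le_bound _ hc fun u => ?_
    refine abs_le_of_sq_le_sq' ?_ (by positivity) |>.2
    rw [sub_apply, ContinuousLinearMap.comp_apply, hPv, norm_sub_sum_inner_sq hb,
      sub_le_iff_le_add]
    refine le_of_tendsto (hA u) ?_
    filter_upwards [Filter.eventually_ge_atTop s] with K hK
    rw [← Finset.sum_sdiff hK]
    gcongr
    exact h u _ Finset.sdiff_disjoint

theorem isWeakBounded_of_rankApprox_box {H : Type*} [NormedAddCommGroup H]
    [InnerProductSpace ℂ H] {A : H →L[ℂ] H} (hd : 0 < d) {s C : ℝ} (hs : 0 ≤ s) (hC : 0 ≤ C)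
    (h : ∀ N : ℕ, RankApprox ((2 * N + 1) ^ d) (C * ((N : ℝ) + 1) ^ (-s)) A) :
    IsWeakBounded (s / d) A := by
  refine ⟨max ‖A‖ (C * 3 ^ s), le_max_of_le_left (norm_nonneg _), fun n => ?_⟩
  -- Even the smallest box has one element, so `n = 0` is covered by `‖A‖`. Otherwise `N` is the
  -- largest box parameter allowed by `n`, and maximality gives `n + 1 ≤ (3(N+1))^d`.
  rcases Nat.eq_zero_or_pos n with rfl | hn
  · refine RankApprox.of_norm_le ?_
    simp
  set N := Nat.findGreatest (fun N => (2 * N + 1) ^ d ≤ n) n with hN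
  have h1 : (2 * N + 1) ^ d ≤ n :=
    Nat.findGreatest_spec (P := fun N => (2 * N + 1) ^ d ≤ n) (Nat.zero_le n)
      (by simpa using Nat.succ_le_of_lt hn)
  have h2 : n < (2 * (N + 1) + 1) ^ d := by
    by_contra! hcon
    have hle : N + 1 ≤ n := by
      refine le_trans ?_ hcon
      exact (by omega : N + 1 ≤ 2 * (N + 1) + 1).trans (Nat.le_self_pow hd.ne' _)
    exact absurd (Nat.le_findGreatest (P := fun N => (2 * N + 1) ^ d ≤ n) hle hcon) (by omega)
  have h3 : ((n : ℝ) + 1) ≤ (3 * ((N : ℝ) + 1)) ^ d := by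
    have : n + 1 ≤ (3 * (N + 1)) ^ d :=
      (Nat.succ_le_of_lt h2).trans (Nat.pow_le_pow_left (by omega) d)
    exact_mod_cast this
  refine (h N).mono h1 ?_
  have hd' : (d : ℝ) ≠ 0 := by exact_mod_cast hd.ne'
  have h4 : (3 * ((N : ℝ) + 1)) ^ (-s) ≤ ((n : ℝ) + 1) ^ (-(s / d)) := by
    have e : (3 * ((N : ℝ) + 1)) ^ (-s) = ((3 * ((N : ℝ) + 1)) ^ d) ^ (-(s / d)) := by
      rw [← Real.rpow_natCast, ← Real.rpow_mul (by positivity)]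
      congr 1
      field_simp
    rw [e]
    exact Real.rpow_le_rpow_of_nonpos (by positivity) h3 (neg_nonpos.mpr (by positivity))
  rw [Real.mul_rpow (by norm_num) (by positivity), Real.rpow_neg (by norm_num)] at h4
  calc C * ((N : ℝ) + 1) ^ (-s) = C * 3 ^ s * ((3 ^ s)⁻¹ * ((N : ℝ) + 1) ^ (-s)) := by
        field_simp
    _ ≤ C * 3 ^ s * ((n : ℝ) + 1) ^ (-(s / d)) := by gcongr
    _ ≤ _ := by
        gcongr
        exact le_max_right _ _

/-- An operator with range supported in a cube whose adjoint sends the exponentials of the cube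
to functions with localized Fourier transforms of decreasing size is in a weak Schatten class. -/
theorem isWeakBounded_of_fourier_decay (hd : 0 < d) {L : ℝ} (hL : 0 < L) {A : L2 d →L[ℂ] L2 d}
    (hA : ∀ u, ∀ᵐ x, x ∉ cube d L → A u x = 0) {s C : ℝ} (hs : 0 ≤ s) (hC : 0 ≤ C)
    (h : ∀ k, ∀ᵐ ξ, ‖(𝓕 (ContinuousLinearMap.adjoint A (cubeExp L k)) : L2 d) ξ‖ ≤
      C * (1 + ‖freq L k‖) ^ (-s) * decay (ξ - freq L k)) :
    IsWeakBounded (s / d) A := by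
  classical
  obtain ⟨S, hS, hsum⟩ := sum_sq_inner_le_of_fourier_decay (d := d) hL
  refine isWeakBounded_of_rankApprox_box (C := S * C * (L⁻¹) ^ (-s)) hd hs (by positivity)
    fun N => ?_
  set box : Finset (Fin d → ℤ) := Fintype.piFinset fun _ => Finset.Icc (-(N : ℤ)) N with hbox
  have hcard : box.card = (2 * N + 1) ^ d := by
    rw [hbox, Fintype.card_piFinset]
    simp only [Int.card_Icc, Finset.prod_const, Finset.card_univ, Fintype.card_fin]
    congr 1
    omega
  rw [← hcard]
  refine rankApprox_of_forall_sum_le (orthonormal_cubeExp hL)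
    (fun u => hasSum_sq_inner_cubeExp hL _ (hA u)) box (by positivity) fun u K hK => ?_
  -- Outside the box some `|k i| ≥ N + 1`, so the frequency has norm at least `(N + 1) / L`.
  have hδ : 0 ≤ C * (L⁻¹ * ((N : ℝ) + 1)) ^ (-s) := by positivity
  have := hsum (fun k => ContinuousLinearMap.adjoint A (cubeExp L k)) _ K hδ (fun k hk => ?_) u
  · simp only [ContinuousLinearMap.adjoint_inner_left] at this
    refine this.trans (le_of_eq ?_)
    rw [Real.mul_rpow (by positivity) (by positivity)]
    ring
  · filter_upwards [h k] with ξ hξ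
    refine hξ.trans ?_
    have hpos := (decay_pos (ξ - freq L k)).le
    refine mul_le_mul_of_nonneg_right (mul_le_mul_of_nonneg_left ?_ hC) hpos
    refine Real.rpow_le_rpow_of_nonpos (by positivity) ?_ (by linarith)
    have hk' : k ∉ box := Finset.disjoint_left.mp hK hk
    obtain ⟨i, hi⟩ : ∃ i, ¬ (-(N : ℤ) ≤ k i ∧ k i ≤ N) := by
      by_contra! hcon
      exact hk' (Fintype.mem_piFinset.mpr fun i => Finset.mem_Icc.mpr (hcon i))
    have hki : (N : ℤ) + 1 ≤ |k i| := by
      by_contra! hcon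
      exact hi (abs_le.mp (by omega))
    have hki' : ((N : ℝ) + 1) ≤ |(k i : ℝ)| := by exact_mod_cast hki
    calc L⁻¹ * ((N : ℝ) + 1) ≤ |(k i : ℝ)| / L := by
          rw [inv_mul_eq_div]
          gcongr
      _ ≤ ‖freq L k‖ := abs_le_norm_freq hL k i
      _ ≤ _ := by linarith

end Counting

/-! ### Modulations, products and Bessel potentials on Schwartz functions. -/

section Schwartz

open scoped ComplexConjugate SchwartzMap

variable {d : ℕ}

/-- The modulation `x ↦ exp (2πi⟨κ, x⟩) h x` of a Schwartz function. -/
def modulate (κ : Rd d) (h : 𝓢(Rd d, ℂ)) : 𝓢(Rd d, ℂ) :=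
  𝓕⁻ (SchwartzMap.compSubConstCLM ℂ κ (𝓕 h))

theorem fourier_modulate (κ : Rd d) (h : 𝓢(Rd d, ℂ)) (ξ : Rd d) :
    (𝓕 (modulate κ h)) ξ = (𝓕 h) (ξ - κ) := by
  rw [modulate, FourierTransform.fourier_fourierInv_eq]
  rfl

theorem modulate_apply (κ : Rd d) (h : 𝓢(Rd d, ℂ)) (x : Rd d) :
    modulate κ h x = character κ x * h x := by
  have h0 : h x = (𝓕⁻ (𝓕 h)) x := by rw [FourierTransform.fourierInv_fourier_eq]
  rw [h0, modulate, SchwartzMap.fourierInv_coe, SchwartzMap.fourierInv_coe, Real.fourierInv_eq,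
    Real.fourierInv_eq, ← integral_const_mul,
    ← integral_sub_right_eq_self (fun v => character κ x * _) κ]
  congr 1
  ext v
  have hv : inner ℝ v x = inner ℝ κ x + inner ℝ (v - κ) x := by rw [← inner_add_left]; congr 1; abel
  rw [hv, AddChar.map_add_eq_mul, mul_smul]
  rfl

/-- The pointwise product of Schwartz functions. -/
def schwartzMul (g h : 𝓢(Rd d, ℂ)) : 𝓢(Rd d, ℂ) :=
  SchwartzMap.pairing (ContinuousLinearMap.mul ℂ ℂ) g h

theorem schwartzMul_apply (g h : 𝓢(Rd d, ℂ)) (x : Rd d) : schwartzMul g h x = g x * h x := rfl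

theorem fourier_schwartzMul (g h : 𝓢(Rd d, ℂ)) (ξ : Rd d) :
    (𝓕 (schwartzMul g h)) ξ = ∫ η, (𝓕 g) η * (𝓕 h) (ξ - η) := by
  have hneg : ∀ (f : 𝓢(Rd d, ℂ)) (x : Rd d), (𝓕⁻ f) x = (𝓕 f) (-x) := fun f x => rfl
  have h1 : SchwartzMap.convolution (ContinuousLinearMap.mul ℂ ℂ) (𝓕⁻ g) (𝓕⁻ h) =
      𝓕⁻ (schwartzMul g h) := by
    simp [SchwartzMap.convolution, schwartzMul]
  -- The inverse transform is the reflected transform, hence the evaluation at `-ξ` and the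
  -- substitution `t ↦ -t` below.
  have h2 : (𝓕 (schwartzMul g h)) ξ =
      SchwartzMap.convolution (ContinuousLinearMap.mul ℂ ℂ) (𝓕⁻ g) (𝓕⁻ h) (-ξ) := by
    rw [h1, hneg, neg_neg]
  rw [h2, SchwartzMap.convolution_apply, convolution_def]
  refine Eq.trans ?_ (integral_neg_eq_self (fun t => (𝓕 g) t * (𝓕 h) (ξ - t)) volume)
  congr 1
  ext t
  rw [ContinuousLinearMap.mul_apply', hneg, hneg]
  congr 2
  abel

theorem exists_norm_schwartz_le (h : 𝓢(Rd d, ℂ)) (n : ℕ) :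
    ∃ C : ℝ, 0 ≤ C ∧ ∀ x, ‖h x‖ ≤ C * ((1 + ‖x‖) ^ n)⁻¹ := by
  refine ⟨2 ^ n * (Finset.Iic (n, 0)).sup (fun m => SchwartzMap.seminorm ℝ m.1 m.2) h,
    by positivity, fun x => ?_⟩
  have := SchwartzMap.one_add_le_sup_seminorm_apply (𝕜 := ℝ) (m := (n, 0)) le_rfl le_rfl h x
  rw [norm_iteratedFDeriv_zero] at this
  rw [← div_eq_mul_inv, le_div_iff₀ (by positivity), mul_comm]
  exact this

/-- The symbol of `(1 - Δ)^{-p/2}` in the normalization of the Fourier transform. -/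
def besselWeight (p : ℝ) (ξ : Rd d) : ℝ := (1 + ‖(2 * Real.pi) • ξ‖ ^ 2) ^ (-(p / 2))

theorem besselSymbol_smul (p : ℝ) (ξ : Rd d) :
    besselSymbol d p ((2 * Real.pi) • ξ) = (besselWeight p ξ : ℂ) := rfl

theorem hasTemperateGrowth_besselWeight (p : ℝ) :
    (fun ξ : Rd d => (besselWeight p ξ : ℂ)).HasTemperateGrowth := by
  have h1 := Function.hasTemperateGrowth_one_add_norm_sq_rpow (Rd d) (-(p / 2))
  have h2 : (fun ξ : Rd d => (2 * Real.pi) • ξ).HasTemperateGrowth :=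
    ((2 * Real.pi) • ContinuousLinearMap.id ℝ (Rd d)).hasTemperateGrowth
  exact Function.HasTemperateGrowth.comp Function.Complex.hasTemperateGrowth_ofReal
    (Function.HasTemperateGrowth.comp h1 h2)

/-- The operator `(1 - Δ)^{-p/2}` on Schwartz functions. -/
def besselSchwartz (p : ℝ) (h : 𝓢(Rd d, ℂ)) : 𝓢(Rd d, ℂ) :=
  𝓕⁻ (SchwartzMap.smulLeftCLM ℂ (fun ξ : Rd d => (besselWeight p ξ : ℂ)) (𝓕 h))

theorem fourier_besselSchwartz (p : ℝ) (h : 𝓢(Rd d, ℂ)) (ξ : Rd d) :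
    (𝓕 (besselSchwartz p h) : 𝓢(Rd d, ℂ)) ξ = (besselWeight p ξ : ℂ) * (𝓕 h : 𝓢(Rd d, ℂ)) ξ := by
  rw [besselSchwartz, FourierTransform.fourier_fourierInv_eq,
    SchwartzMap.smulLeftCLM_apply_apply (hasTemperateGrowth_besselWeight p), smul_eq_mul]

theorem fourier_toLp_ae (h : 𝓢(Rd d, ℂ)) :
    (𝓕 (h.toLp 2 : L2 d) : L2 d) =ᵐ[volume] (𝓕 h : 𝓢(Rd d, ℂ)) := by
  rw [SchwartzMap.toLp_fourier_eq]
  exact (𝓕 h).coeFn_toLp 2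

theorem besselOp_toLp {p : ℝ} (hp : 0 < p) (h : 𝓢(Rd d, ℂ)) :
    besselOp d p hp (h.toLp 2) = (besselSchwartz p h).toLp 2 := by
  apply eq_of_fourier_ae_eq
  filter_upwards [fourier_gradOp_ae _ (isBoundedBorel_besselSymbol d hp) (h.toLp 2 : L2 d),
    fourier_toLp_ae h, fourier_toLp_ae (besselSchwartz p h)] with ξ h1 h2 h3
  rw [besselOp, h1, h2, h3, besselSymbol_smul, fourier_besselSchwartz]

theorem mulOp_toLp {f : Rd d → ℂ} (hf : IsBoundedBorel f) (g h : 𝓢(Rd d, ℂ))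
    (hfg : ∀ x, f x = g x) :
    mulOp f hf (h.toLp 2) = (schwartzMul g h).toLp 2 := by
  apply Lp.ext
  filter_upwards [mulOp_apply_ae f hf (h.toLp 2 : L2 d), h.coeFn_toLp 2,
    (schwartzMul g h).coeFn_toLp 2] with x h1 h2 h3
  rw [h1, h2, h3, hfg, schwartzMul_apply]

/-- Since `χ` vanishes off the cube, the sharp cut-off of the exponential disappears and the product
is a Schwartz function. -/
theorem mulOp_cubeExp {L : ℝ} {χ : Rd d → ℂ} (hχ : IsBoundedBorel χ)
    (hsupp : ∀ x, x ∉ cube d L → χ x = 0) (h : 𝓢(Rd d, ℂ)) (hh : ∀ x, χ x = h x)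
    (k : Fin d → ℤ) :
    mulOp χ hχ (cubeExp L k) =
      ((Real.sqrt (L ^ d)⁻¹ : ℝ) : ℂ) • ((modulate (freq L k) h).toLp 2 : L2 d) := by
  apply Lp.ext
  filter_upwards [mulOp_apply_ae χ hχ (cubeExp L k), (memLp_cubeExp L k).coeFn_toLp,
    (modulate (freq L k) h).coeFn_toLp 2,
    Lp.coeFn_smul ((Real.sqrt (L ^ d)⁻¹ : ℝ) : ℂ) ((modulate (freq L k) h).toLp 2 : L2 d)]
    with x h1 h2 h3 h4
  rw [h1, h4, Pi.smul_apply, h3, modulate_apply, cubeExp, h2, smul_eq_mul]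
  by_cases hx : x ∈ cube d L
  · rw [Set.indicator_of_mem hx, hh]
    ring
  · rw [hsupp x hx, ← hh, hsupp x hx]
    simp

end Schwartz

/-! ### Decay and differences of the Bessel symbol. -/

section SymbolEstimates

variable {d : ℕ}

theorem rpow_neg_one_add_norm_le {s : ℝ} (hs : 0 ≤ s) (x y : Rd d) :
    (1 + ‖x‖) ^ (-s) ≤ (1 + ‖y‖) ^ (-s) * (1 + ‖x - y‖) ^ s := by
  have h := one_add_norm_le_mul y (x - y)
  rw [add_sub_cancel] at h
  have h2 : (1 + ‖y‖) ^ s ≤ (1 + ‖x‖) ^ s * (1 + ‖x - y‖) ^ s := by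
    rw [← Real.mul_rpow (by positivity) (by positivity)]
    exact Real.rpow_le_rpow (by positivity) h hs
  rw [Real.rpow_neg (by positivity), Real.rpow_neg (by positivity), ← div_eq_inv_mul,
    inv_eq_one_div, div_le_div_iff₀ (by positivity) (by positivity), one_mul, mul_comm]
  exact h2

theorem one_add_sq_rpow_neg_le {s t : ℝ} (hs : 0 ≤ s) (ht : 0 ≤ t) :
    (1 + t ^ 2) ^ (-(s / 2)) ≤ 2 ^ (s / 2) * (1 + t) ^ (-s) := by
  have h := rpow_neg_le_of_le_two_mul (α := s / 2) (by positivity)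
    (x := (1 + t) ^ 2) (y := 1 + t ^ 2) (by positivity) (by nlinarith [sq_nonneg (t - 1)])
  refine h.trans (le_of_eq ?_)
  rw [← Real.rpow_natCast (1 + t) 2, ← Real.rpow_mul (by positivity)]
  congr 2
  push_cast
  ring

theorem two_pi_norm (ξ : Rd d) : ‖(2 * Real.pi) • ξ‖ = 2 * Real.pi * ‖ξ‖ := by
  rw [norm_smul, Real.norm_of_nonneg (by positivity)]

theorem norm_le_two_pi_norm (ξ : Rd d) : ‖ξ‖ ≤ ‖(2 * Real.pi) • ξ‖ := by
  rw [two_pi_norm]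
  nlinarith [Real.pi_gt_three, norm_nonneg ξ]

theorem besselWeight_nonneg (p : ℝ) (ξ : Rd d) : 0 ≤ besselWeight p ξ := by
  unfold besselWeight
  positivity

theorem besselWeight_le {p : ℝ} (hp : 0 ≤ p) (ξ : Rd d) :
    besselWeight p ξ ≤ 2 ^ (p / 2) * (1 + ‖ξ‖) ^ (-p) := by
  refine (one_add_sq_rpow_neg_le hp (norm_nonneg _)).trans ?_
  gcongr 2 ^ (p / 2) * ?_
  exact Real.rpow_le_rpow_of_nonpos (by positivity) (by linarith [norm_le_two_pi_norm ξ])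
    (by linarith)

/-- Mean value theorem: differentiating the symbol gains one power of decay, and any point between
`t` and `r` is comparable with `t` up to a factor `1 + |r - t|`. -/
theorem abs_one_add_sq_rpow_sub_le {p : ℝ} (hp : 0 ≤ p) {r t : ℝ} (ht : 0 ≤ t)
    (hr : 0 ≤ r) :
    |(1 + r ^ 2) ^ (-(p / 2)) - (1 + t ^ 2) ^ (-(p / 2))| ≤
      p * 2 ^ ((p + 1) / 2) * (1 + |r - t|) ^ (p + 1) * (1 + t) ^ (-(p + 1)) * |r - t| := by
  have hder : ∀ x : ℝ, HasDerivAt (fun x : ℝ => (1 + x ^ 2) ^ (-(p / 2)))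
      (2 * x * (-(p / 2)) * (1 + x ^ 2) ^ (-(p / 2) - 1)) x := fun x => by
    have h1 : HasDerivAt (fun x : ℝ => 1 + x ^ 2) (2 * x) x := by
      simpa using (hasDerivAt_pow 2 x).const_add 1
    exact h1.rpow_const (Or.inl (by positivity))
  have hbound : ∀ x ∈ Set.uIcc t r, ‖2 * x * (-(p / 2)) * (1 + x ^ 2) ^ (-(p / 2) - 1)‖ ≤
      p * 2 ^ ((p + 1) / 2) * (1 + |r - t|) ^ (p + 1) * (1 + t) ^ (-(p + 1)) := fun x hx => by
    have hx0 : 0 ≤ x := by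
      rcases Set.mem_uIcc.mp hx with h | h <;> linarith [h.1]
    have hxt : |x - t| ≤ |r - t| := Set.abs_sub_left_of_mem_uIcc hx
    have h1 : ‖2 * x * (-(p / 2)) * (1 + x ^ 2) ^ (-(p / 2) - 1)‖ =
        p * (x * (1 + x ^ 2) ^ (-(p / 2) - 1)) := by
      rw [Real.norm_eq_abs, abs_mul, abs_of_nonneg (by positivity : 0 ≤ (1 + x ^ 2) ^ (-(p / 2) - 1))]
      have : |2 * x * (-(p / 2))| = p * x := by
        rw [show 2 * x * (-(p / 2)) = -(p * x) by ring, abs_neg, abs_of_nonneg (by positivity)]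
      rw [this]
      ring
    have h2 : x * (1 + x ^ 2) ^ (-(p / 2) - 1) ≤ (1 + x ^ 2) ^ (-((p + 1) / 2)) := by
      have hx' : x ≤ (1 + x ^ 2) ^ (1 / 2 : ℝ) := by
        rw [← Real.sqrt_eq_rpow]
        exact Real.le_sqrt_of_sq_le (by linarith)
      calc x * (1 + x ^ 2) ^ (-(p / 2) - 1)
          ≤ (1 + x ^ 2) ^ (1 / 2 : ℝ) * (1 + x ^ 2) ^ (-(p / 2) - 1) := by gcongr
        _ = _ := by
          rw [← Real.rpow_add (by positivity)]
          congr 1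
          ring
    have h3 : (1 + x) ^ (-(p + 1)) ≤ (1 + |r - t|) ^ (p + 1) * (1 + t) ^ (-(p + 1)) := by
      have hle : 1 + t ≤ (1 + x) * (1 + |r - t|) := by
        nlinarith [neg_abs_le (x - t), abs_nonneg (r - t)]
      have := Real.rpow_le_rpow (by positivity) hle (by positivity : 0 ≤ p + 1)
      rw [Real.mul_rpow (by positivity) (by positivity)] at this
      rw [Real.rpow_neg (by positivity), Real.rpow_neg (by positivity), ← div_eq_mul_inv,
        inv_eq_one_div, div_le_div_iff₀ (by positivity) (by positivity), one_mul, mul_comm]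
      exact this
    rw [h1]
    calc p * (x * (1 + x ^ 2) ^ (-(p / 2) - 1))
        ≤ p * (2 ^ ((p + 1) / 2) * ((1 + |r - t|) ^ (p + 1) * (1 + t) ^ (-(p + 1)))) := by
          refine mul_le_mul_of_nonneg_left ?_ hp
          exact h2.trans ((one_add_sq_rpow_neg_le (by positivity) hx0).trans (by gcongr))
      _ = _ := by ring
  have := Convex.norm_image_sub_le_of_norm_hasDerivWithin_le
    (fun x _ => (hder x).hasDerivWithinAt) hbound (convex_uIcc t r) Set.left_mem_uIcc
    Set.right_mem_uIcc
  simpa only [Real.norm_eq_abs] using this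

/-- The symbol is radial, so the one-variable estimate applies. The exponent `-(p + 1)`, against
`-p` for the symbol itself, is the source of the gain for commutators; the growth in `ξ - η` will be
absorbed by Schwartz decay. -/
theorem abs_besselWeight_sub_le {p : ℝ} (hp : 0 ≤ p) :
    ∃ C : ℝ, 0 ≤ C ∧ ∀ ξ η : Rd d, |besselWeight p ξ - besselWeight p η| ≤
      C * (1 + ‖ξ - η‖) ^ (p + 2) * (1 + ‖η‖) ^ (-(p + 1)) := by
  have hpi := Real.pi_gt_three
  refine ⟨p * 2 ^ ((p + 1) / 2) * (2 * Real.pi) ^ (p + 2), by positivity, fun ξ η => ?_⟩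
  have h := abs_one_add_sq_rpow_sub_le hp (r := ‖(2 * Real.pi) • ξ‖) (norm_nonneg ((2 * Real.pi) • η)) (norm_nonneg _)
  have hdiff : |‖(2 * Real.pi) • ξ‖ - ‖(2 * Real.pi) • η‖| ≤ 2 * Real.pi * ‖ξ - η‖ := by
    refine (abs_norm_sub_norm_le _ _).trans (le_of_eq ?_)
    rw [← smul_sub, two_pi_norm]
  set δ := |‖(2 * Real.pi) • ξ‖ - ‖(2 * Real.pi) • η‖| with hδ
  have hδ0 : 0 ≤ δ := abs_nonneg _
  have h1 : (1 + δ) ^ (p + 1) * δ ≤ (2 * Real.pi) ^ (p + 2) * (1 + ‖ξ - η‖) ^ (p + 2) := by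
    have hle : 1 + δ ≤ 2 * Real.pi * (1 + ‖ξ - η‖) := by linarith
    calc (1 + δ) ^ (p + 1) * δ ≤ (1 + δ) ^ (p + 1) * (1 + δ) := by
          gcongr
          linarith
      _ = (1 + δ) ^ (p + 2) := by
          rw [← Real.rpow_add_one (by positivity)]
          congr 1
          ring
      _ ≤ (2 * Real.pi * (1 + ‖ξ - η‖)) ^ (p + 2) :=
          Real.rpow_le_rpow (by positivity) hle (by positivity)
      _ = _ := Real.mul_rpow (by positivity) (by positivity)
  have h2 : (1 + ‖(2 * Real.pi) • η‖) ^ (-(p + 1)) ≤ (1 + ‖η‖) ^ (-(p + 1)) :=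
    Real.rpow_le_rpow_of_nonpos (by positivity) (by linarith [norm_le_two_pi_norm η]) (by linarith)
  refine h.trans ?_
  calc p * 2 ^ ((p + 1) / 2) * (1 + δ) ^ (p + 1) * (1 + ‖(2 * Real.pi) • η‖) ^ (-(p + 1)) * δ
      = p * 2 ^ ((p + 1) / 2) * ((1 + δ) ^ (p + 1) * δ) *
          (1 + ‖(2 * Real.pi) • η‖) ^ (-(p + 1)) := by ring
    _ ≤ p * 2 ^ ((p + 1) / 2) * ((2 * Real.pi) ^ (p + 2) * (1 + ‖ξ - η‖) ^ (p + 2)) *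
          (1 + ‖η‖) ^ (-(p + 1)) := by gcongr
    _ = _ := by ring

end SymbolEstimates

/-! ### Weak Schatten bounds for localized Bessel potentials and commutators. -/

section BesselBounds

open scoped ComplexConjugate SchwartzMap

variable {d : ℕ}

theorem isWeakBounded_of_schwartz_decay (hd : 0 < d) {L : ℝ} (hL : 0 < L)
    {A : L2 d →L[ℂ] L2 d} (hA : ∀ u, ∀ᵐ x, x ∉ cube d L → A u x = 0) {s C : ℝ} (hs : 0 ≤ s)
    (hC : 0 ≤ C) (w : (Fin d → ℤ) → 𝓢(Rd d, ℂ)) (c : ℂ)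
    (hw : ∀ k, ContinuousLinearMap.adjoint A (cubeExp L k) = c • ((w k).toLp 2 : L2 d))
    (h : ∀ k ξ, ‖(𝓕 (w k) : 𝓢(Rd d, ℂ)) ξ‖ ≤
      C * (1 + ‖freq L k‖) ^ (-s) * decay (ξ - freq L k)) :
    IsWeakBounded (s / d) A := by
  refine isWeakBounded_of_fourier_decay hd hL hA hs (C := ‖c‖ * C) (by positivity) fun k => ?_
  have h1 : (𝓕 (ContinuousLinearMap.adjoint A (cubeExp L k)) : L2 d) =
      c • (𝓕 ((w k).toLp 2 : L2 d) : L2 d) := by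
    rw [hw, FourierTransform.fourier_smul]
  rw [h1]
  filter_upwards [Lp.coeFn_smul c (𝓕 ((w k).toLp 2 : L2 d) : L2 d), fourier_toLp_ae (w k)]
    with ξ h2 h3
  rw [h2, Pi.smul_apply, h3, norm_smul, mul_assoc, mul_assoc]
  gcongr
  rw [← mul_assoc]
  exact h k ξ

theorem mulOp_apply_ae_eq_zero {L : ℝ} {χ : Rd d → ℂ} (hχ : IsBoundedBorel χ)
    (hsupp : ∀ x, x ∉ cube d L → χ x = 0) (u : L2 d) :
    ∀ᵐ x, x ∉ cube d L → mulOp χ hχ u x = 0 := by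
  filter_upwards [mulOp_apply_ae χ hχ u] with x hx hxc
  rw [hx, hsupp x hxc, zero_mul]

theorem exists_cube_of_hasCompactSupport {χ : Rd d → ℂ} (hχ : HasCompactSupport χ) :
    ∃ L : ℝ, 0 < L ∧ ∀ x, x ∉ cube d L → χ x = 0 := by
  obtain ⟨R, hR, hsub⟩ := hχ.isCompact.isBounded.subset_closedBall_lt 0 0
  refine ⟨2 * R + 2, by positivity, fun x hx => ?_⟩
  by_contra hne
  apply hx
  have hxR : ‖x‖ ≤ R := by simpa using hsub (subset_tsupport _ hne)
  intro i
  have := (PiLp.norm_apply_le x i).trans hxR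
  rw [Real.norm_eq_abs, abs_le] at this
  constructor <;> linarith [this.1, this.2]

theorem exists_schwartz_conj {χ : Rd d → ℂ} (hχ : ContDiff ℝ ∞ χ) (hc : HasCompactSupport χ) :
    ∃ h : 𝓢(Rd d, ℂ), ∀ x, conj (χ x) = h x := by
  have h1 : ContDiff ℝ ∞ (fun x => conj (χ x)) :=
    (Complex.conjCLE : ℂ →L[ℝ] ℂ).contDiff.comp hχ
  have h2 : HasCompactSupport (fun x => conj (χ x)) := hc.comp_left (map_zero _)
  exact ⟨h2.toSchwartzMap h1, fun x => rfl⟩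

/-- Schwartz functions decay faster than any real power, with a `decay` factor to spare. -/
theorem exists_norm_schwartz_le_rpow (h : 𝓢(Rd d, ℂ)) (s : ℝ) (n : ℕ) :
    ∃ C : ℝ, 0 ≤ C ∧ ∀ x, (1 + ‖x‖) ^ s * ‖h x‖ ≤ C * ((1 + ‖x‖) ^ n)⁻¹ := by
  obtain ⟨C, hC, hle⟩ := exists_norm_schwartz_le h (⌈s⌉₊ + n)
  refine ⟨C, hC, fun x => ?_⟩
  have hs : (1 + ‖x‖) ^ s ≤ (1 + ‖x‖) ^ ⌈s⌉₊ := by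
    rw [← Real.rpow_natCast]
    exact Real.rpow_le_rpow_of_exponent_le (by linarith [norm_nonneg x]) (Nat.le_ceil s)
  calc (1 + ‖x‖) ^ s * ‖h x‖ ≤ (1 + ‖x‖) ^ ⌈s⌉₊ * (C * ((1 + ‖x‖) ^ (⌈s⌉₊ + n))⁻¹) := by
        gcongr
        exact hle x
    _ = _ := by
        rw [pow_add]
        field_simp

/-- For smooth compactly supported `χ`, the operator `M_χ (1 - Δ)^{-p/2}` is in `L_{d/p,∞}`. -/
theorem isWeakBounded_mulOp_comp_besselOp (hd : 0 < d) {p : ℝ} (hp : 0 < p) {χ : Rd d → ℂ}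
    (hχ : ContDiff ℝ ∞ χ) (hc : HasCompactSupport χ) (hb : IsBoundedBorel χ) :
    IsWeakBounded (p / d) (mulOp χ hb ∘L besselOp d p hp) := by
  obtain ⟨L, hL, hsupp⟩ := exists_cube_of_hasCompactSupport hc
  obtain ⟨h, hh⟩ := exists_schwartz_conj hχ hc
  obtain ⟨C, hC, hle⟩ := exists_norm_schwartz_le_rpow (𝓕 h : 𝓢(Rd d, ℂ)) p (d + 1)
  refine isWeakBounded_of_schwartz_decay hd hL
    (fun u => mulOp_apply_ae_eq_zero hb hsupp (besselOp d p hp u)) hp.le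
    (C := 2 ^ (p / 2) * C) (by positivity)
    (fun k => besselSchwartz p (modulate (freq L k) h)) ((Real.sqrt (L ^ d)⁻¹ : ℝ) : ℂ)
    (fun k => ?_) fun k ξ => ?_
  · rw [ContinuousLinearMap.adjoint_comp, adjoint_besselOp, adjoint_mulOp,
      ContinuousLinearMap.comp_apply,
      mulOp_cubeExp hb.conj (fun x hx => by rw [hsupp x hx, map_zero]) h hh, map_smul,
      besselOp_toLp]
  · rw [fourier_besselSchwartz, fourier_modulate, norm_mul, Complex.norm_real,
      Real.norm_of_nonneg (besselWeight_nonneg _ _)]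
    -- Peetre's inequality moves the weight from `ξ` to `freq L k`; the resulting factor is absorbed
    -- by the rapid decay of `𝓕 h`.
    calc besselWeight p ξ * ‖(𝓕 h : 𝓢(Rd d, ℂ)) (ξ - freq L k)‖
        ≤ 2 ^ (p / 2) * ((1 + ‖freq L k‖) ^ (-p) * (1 + ‖ξ - freq L k‖) ^ p) *
            ‖(𝓕 h : 𝓢(Rd d, ℂ)) (ξ - freq L k)‖ := by
          gcongr
          refine (besselWeight_le hp.le ξ).trans ?_
          gcongr
          exact rpow_neg_one_add_norm_le hp.le _ _
      _ = 2 ^ (p / 2) * (1 + ‖freq L k‖) ^ (-p) *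
            ((1 + ‖ξ - freq L k‖) ^ p * ‖(𝓕 h : 𝓢(Rd d, ℂ)) (ξ - freq L k)‖) := by ring
      _ ≤ 2 ^ (p / 2) * (1 + ‖freq L k‖) ^ (-p) * (C * decay (ξ - freq L k)) := by
          exact mul_le_mul_of_nonneg_left (hle _) (by positivity)
      _ = _ := by ring

/-- The Schwartz function `[(1 - Δ)^{-p/2}, M_g] h`. -/
def commSchwartz (p : ℝ) (g h : 𝓢(Rd d, ℂ)) : 𝓢(Rd d, ℂ) :=
  besselSchwartz p (schwartzMul g h) - schwartzMul g (besselSchwartz p h)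

theorem fourier_commSchwartz {p : ℝ} (g h : 𝓢(Rd d, ℂ)) (ξ : Rd d) :
    (𝓕 (commSchwartz p g h) : 𝓢(Rd d, ℂ)) ξ =
      ∫ η, (𝓕 g : 𝓢(Rd d, ℂ)) η *
        (((besselWeight p ξ - besselWeight p (ξ - η) : ℝ) : ℂ) * (𝓕 h : 𝓢(Rd d, ℂ)) (ξ - η)) := by
  have hint : ∀ f : 𝓢(Rd d, ℂ),
      Integrable fun η => (𝓕 g : 𝓢(Rd d, ℂ)) η * (𝓕 f : 𝓢(Rd d, ℂ)) (ξ - η) := fun f => by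
    obtain ⟨C, -, hC⟩ := exists_norm_schwartz_le (𝓕 f : 𝓢(Rd d, ℂ)) 0
    refine (𝓕 g : 𝓢(Rd d, ℂ)).integrable.mul_bdd (c := C) ?_ (Filter.Eventually.of_forall fun η => ?_)
    · exact ((𝓕 f : 𝓢(Rd d, ℂ)).continuous.comp (continuous_const.sub continuous_id)).aestronglyMeasurable
    · simpa using hC (ξ - η)
  have hsub : (𝓕 (commSchwartz p g h) : 𝓢(Rd d, ℂ)) =
      𝓕 (besselSchwartz p (schwartzMul g h)) - 𝓕 (schwartzMul g (besselSchwartz p h)) := by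
    exact map_sub (FourierTransform.fourierCLM ℂ 𝓢(Rd d, ℂ)) _ _
  rw [hsub, sub_apply, fourier_besselSchwartz, fourier_schwartzMul,
    fourier_schwartzMul, ← integral_const_mul,
    ← integral_sub ((hint h).const_mul _) (hint (besselSchwartz p h))]
  congr 1
  ext η
  rw [fourier_besselSchwartz]
  push_cast
  ring

/-- The Fourier transform of `[(1 - Δ)^{-p/2}, M_g] (e_κ h)` is of size `|κ|^{-(p+1)}` and
concentrated near `κ`. -/
theorem exists_norm_fourier_commSchwartz_le {p : ℝ} (hp : 0 ≤ p) (g h : 𝓢(Rd d, ℂ)) :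
    ∃ C : ℝ, 0 ≤ C ∧ ∀ κ ξ : Rd d,
      ‖(𝓕 (commSchwartz p g (modulate κ h)) : 𝓢(Rd d, ℂ)) ξ‖ ≤
        C * (1 + ‖κ‖) ^ (-(p + 1)) * decay (ξ - κ) := by
  obtain ⟨B, hB, hbes⟩ := abs_besselWeight_sub_le (d := d) hp
  -- The power `p + 2` pays for the difference of symbols, one `d + 1` for recentring `decay` from
  -- `ξ - η - κ` to `ξ - κ`, the other for integrability in `η`. On `𝓕 h`, the power `p + 1` pays
  -- for moving the weight from `ξ - η` to `κ`.
  obtain ⟨G, hG, hg⟩ := exists_norm_schwartz_le_rpow (𝓕 g : 𝓢(Rd d, ℂ)) (p + 2)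
    ((d + 1) + (d + 1))
  obtain ⟨D, hD, hh⟩ := exists_norm_schwartz_le_rpow (𝓕 h : 𝓢(Rd d, ℂ)) (p + 1) (d + 1)
  have hI : 0 ≤ ∫ η : Rd d, decay η := integral_nonneg fun η => (decay_pos η).le
  refine ⟨B * G * D * ∫ η : Rd d, decay η, by positivity, fun κ ξ => ?_⟩
  rw [fourier_commSchwartz]
  have hrhs : B * G * D * (∫ η : Rd d, decay η) * (1 + ‖κ‖) ^ (-(p + 1)) * decay (ξ - κ) =
      ∫ η : Rd d, B * G * D * (1 + ‖κ‖) ^ (-(p + 1)) * decay (ξ - κ) * decay η := by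
    rw [integral_const_mul]
    ring
  rw [hrhs]
  refine norm_integral_le_of_norm_le (integrable_decay.const_mul _)
    (Filter.Eventually.of_forall fun η => ?_)
  rw [norm_mul, norm_mul, Complex.norm_real, Real.norm_eq_abs, fourier_modulate]
  have e1 : ξ - (ξ - η) = η := sub_sub_cancel _ _
  have h1 := hbes ξ (ξ - η)
  rw [e1] at h1
  have h2 := rpow_neg_one_add_norm_le (by positivity : 0 ≤ p + 1) (ξ - η) κ
  have h3 := hh (ξ - η - κ)
  have h4 := hg η
  have h5 : decay (ξ - η - κ) ≤ (1 + ‖η‖) ^ (d + 1) * decay (ξ - κ) := by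
    have := decay_le_mul (ξ - κ) (-η)
    rw [norm_neg] at this
    convert this using 2
    abel
  set a := ‖(𝓕 g : 𝓢(Rd d, ℂ)) η‖
  set b := ‖(𝓕 h : 𝓢(Rd d, ℂ)) (ξ - η - κ)‖
  set K := (1 + ‖κ‖) ^ (-(p + 1)) with hK
  have hK0 : 0 ≤ K := by positivity
  have h6 : (1 + ‖ξ - η - κ‖) ^ (p + 1) * b ≤ D * ((1 + ‖η‖) ^ (d + 1) * decay (ξ - κ)) :=
    h3.trans (mul_le_mul_of_nonneg_left h5 hD)
  have hdec := (decay_pos (ξ - κ)).le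
  calc a * (|besselWeight p ξ - besselWeight p (ξ - η)| * b)
      ≤ a * ((B * (1 + ‖η‖) ^ (p + 2) * (K * (1 + ‖ξ - η - κ‖) ^ (p + 1))) * b) := by
        gcongr
        exact h1.trans (by gcongr)
    _ = B * K * ((1 + ‖η‖) ^ (p + 2) * a) * ((1 + ‖ξ - η - κ‖) ^ (p + 1) * b) := by ring
    _ ≤ B * K * (G * ((1 + ‖η‖) ^ ((d + 1) + (d + 1)))⁻¹) *
          (D * ((1 + ‖η‖) ^ (d + 1) * decay (ξ - κ))) := by gcongr
    _ = B * G * D * K * decay (ξ - κ) * decay η := by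
        rw [pow_add, decay, decay]
        field_simp

theorem adjoint_commutator_toLp {p : ℝ} (hp : 0 < p) {f : Rd d → ℂ} (hf : IsBoundedBorel f)
    (g h : 𝓢(Rd d, ℂ)) (hg : ∀ x, conj (f x) = g x) :
    ContinuousLinearMap.adjoint (mulOp f hf ∘L besselOp d p hp - besselOp d p hp ∘L mulOp f hf)
      (h.toLp 2 : L2 d) = (commSchwartz p g h).toLp 2 := by
  have hsub : ((commSchwartz p g h).toLp 2 : L2 d) =
      (besselSchwartz p (schwartzMul g h)).toLp 2 volume -
        (schwartzMul g (besselSchwartz p h)).toLp 2 volume :=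
    map_sub (SchwartzMap.toLpCLM ℂ ℂ 2 volume) _ _
  rw [hsub, map_sub, ContinuousLinearMap.adjoint_comp, ContinuousLinearMap.adjoint_comp,
    adjoint_besselOp, adjoint_mulOp, sub_apply, ContinuousLinearMap.comp_apply,
    ContinuousLinearMap.comp_apply, besselOp_toLp, mulOp_toLp hf.conj g h hg,
    mulOp_toLp hf.conj g _ hg, besselOp_toLp]

/-- For smooth compactly supported `χ` and `f`, the operator `M_χ [M_f, (1 - Δ)^{-p/2}]` is in
`L_{d/(p+1),∞}`. -/
theorem isWeakBounded_mulOp_comp_commutator (hd : 0 < d) {p : ℝ} (hp : 0 < p) {χ f : Rd d → ℂ}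
    (hχ : ContDiff ℝ ∞ χ) (hχc : HasCompactSupport χ) (hχb : IsBoundedBorel χ)
    (hf : ContDiff ℝ ∞ f) (hfc : HasCompactSupport f) (hfb : IsBoundedBorel f) :
    IsWeakBounded ((p + 1) / d) (mulOp χ hχb ∘L
      (mulOp f hfb ∘L besselOp d p hp - besselOp d p hp ∘L mulOp f hfb)) := by
  obtain ⟨L, hL, hsupp⟩ := exists_cube_of_hasCompactSupport hχc
  obtain ⟨h, hh⟩ := exists_schwartz_conj hχ hχc
  obtain ⟨g, hg⟩ := exists_schwartz_conj hf hfc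
  obtain ⟨C, hC, hle⟩ := exists_norm_fourier_commSchwartz_le hp.le g h
  set B := mulOp f hfb ∘L besselOp d p hp - besselOp d p hp ∘L mulOp f hfb with hB
  have hadj : ∀ k : Fin d → ℤ, ContinuousLinearMap.adjoint (mulOp χ hχb ∘L B) (cubeExp L k) =
      ((Real.sqrt (L ^ d)⁻¹ : ℝ) : ℂ) •
        ((commSchwartz p g (modulate (freq L k) h)).toLp 2 : L2 d) := fun k => by
    rw [ContinuousLinearMap.adjoint_comp, adjoint_mulOp, ContinuousLinearMap.comp_apply,
      mulOp_cubeExp hχb.conj (fun x hx => by rw [hsupp x hx, map_zero]) h hh, map_smul, hB,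
      adjoint_commutator_toLp hp hfb g _ hg]
  have hzero : ∀ u, ∀ᵐ x, x ∉ cube d L → (mulOp χ hχb ∘L B) u x = 0 := fun u =>
    mulOp_apply_ae_eq_zero hχb hsupp (B u)
  have hp1 : 0 ≤ p + 1 := by positivity
  exact isWeakBounded_of_schwartz_decay hd hL hzero hp1 hC _ _ hadj fun k ξ => hle _ _

end BesselBounds

/-! ### The commutator algebra and passage to `Π`. -/

section Commutators

open scoped ComplexConjugate

variable {d : ℕ}

/-- The commutator of `M_f`, for `f` smooth with compact support, and `(1 - Δ)^{-p/2}` is in the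
separable part of `L_{d/p,∞}`. -/
theorem isWeakSmall_commutator_mulOp (hd : 0 < d) {p : ℝ} (hp : 0 < p) {f : Rd d → ℂ}
    (hf : ContDiff ℝ ∞ f) (hfc : HasCompactSupport f) (hfb : IsBoundedBorel f) :
    IsWeakSmall (p / d) (mulOp f hfb ∘L besselOp d p hp - besselOp d p hp ∘L mulOp f hfb) := by
  have hd' : (0 : ℝ) < d := by exact_mod_cast hd
  have hlt : p / d < (p + 1) / d := by
    rw [div_lt_div_iff_of_pos_right hd']
    linarith
  obtain ⟨R, hR, hsub⟩ := hfc.isCompact.isBounded.subset_closedBall_lt 0 0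
  let β : ContDiffBump (0 : Rd d) := ⟨R, R + 1, hR, by linarith⟩
  set χ : Rd d → ℂ := fun x => (β x : ℂ) with hχdef
  have hχ : ContDiff ℝ ∞ χ := Complex.ofRealCLM.contDiff.comp β.contDiff
  have hχc : HasCompactSupport χ := β.hasCompactSupport.comp_left Complex.ofReal_zero
  have hχb : IsBoundedBorel χ := isBoundedBorel_of_compactSupport hχ hχc
  have hχf : ∀ x, χ x * f x = f x := fun x => by
    by_cases hx : f x = 0
    · rw [hx, mul_zero]
    · have : β x = 1 := β.one_of_mem_closedBall (hsub (subset_tsupport _ hx))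
      rw [hχdef]
      simp [this]
  have hfbar : ContDiff ℝ ∞ (fun x => conj (f x)) :=
    (Complex.conjCLE : ℂ →L[ℝ] ℂ).contDiff.comp hf
  have hfbarc : HasCompactSupport (fun x => conj (f x)) := hfc.comp_left (map_zero _)
  set J := besselOp d p hp with hJ
  have h1 : IsWeakSmall (p / d)
      (mulOp χ hχb ∘L (mulOp f hfb ∘L J - J ∘L mulOp f hfb)) :=
    (isWeakBounded_mulOp_comp_commutator hd hp hχ hχc hχb hf hfc hfb).isWeakSmall hlt
  have h2 : IsWeakSmall (p / d) ((mulOp χ hχb ∘L J - J ∘L mulOp χ hχb) ∘L mulOp f hfb) := by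
    -- A localization on the right becomes one on the left under the adjoint; `χ` is real, so the
    -- commutator only changes sign.
    have h3 := ((isWeakBounded_mulOp_comp_commutator hd hp hfbar hfbarc hfb.conj hχ hχc
      hχb).isWeakSmall hlt).adjoint.neg
    rw [← hJ, ContinuousLinearMap.adjoint_comp, map_sub, ContinuousLinearMap.adjoint_comp,
      ContinuousLinearMap.adjoint_comp, hJ, adjoint_besselOp, adjoint_mulOp, adjoint_mulOp,
      ← ContinuousLinearMap.neg_comp, neg_sub] at h3
    rw [mulOp_congr hχb.conj hχb fun x => Complex.conj_ofReal _,
      mulOp_congr hfb.conj.conj hfb fun x => Complex.conj_conj _] at h3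
    exact h3
  have hM : mulOp f hfb = mulOp χ hχb ∘L mulOp f hfb := by
    rw [mulOp_comp]
    exact mulOp_congr _ _ fun x => (hχf x).symm
  -- `J` is not local, so the commutator must be cut off before the cube estimate applies. Leibniz
  -- for `f = χ f` leaves `χ` on the left of one term and `f` on the right of the other.
  have key : mulOp f hfb ∘L J - J ∘L mulOp f hfb =
      mulOp χ hχb ∘L (mulOp f hfb ∘L J - J ∘L mulOp f hfb) +
        (mulOp χ hχb ∘L J - J ∘L mulOp χ hχb) ∘L mulOp f hfb := by
    rw [ContinuousLinearMap.comp_sub, ContinuousLinearMap.sub_comp,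
      ← ContinuousLinearMap.comp_assoc, ← hM, ContinuousLinearMap.comp_assoc J, ← hM,
      ContinuousLinearMap.comp_assoc]
    abel
  rw [key]
  exact h1.add (by positivity) h2

/-- The star algebra of operators whose commutator with `(1 - Δ)^{-p/2}` is in the separable part
of `L_{d/p,∞}`. -/
def commAlg (d : ℕ) (p : ℝ) (hp : 0 < p) : StarSubalgebra ℂ (L2 d →L[ℂ] L2 d) where
  carrier := {S | IsWeakSmall (p / d) (S ∘L besselOp d p hp - besselOp d p hp ∘L S)}
  mul_mem' {S T} hS hT := by
    change IsWeakSmall _ _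
    have : (S * T) ∘L besselOp d p hp - besselOp d p hp ∘L (S * T) =
        S ∘L (T ∘L besselOp d p hp - besselOp d p hp ∘L T) +
          (S ∘L besselOp d p hp - besselOp d p hp ∘L S) ∘L T := by
      ext1 u
      simp
    rw [this]
    exact (IsWeakSmall.comp_left hT S).add (by positivity) (IsWeakSmall.comp_right hS T)
  add_mem' {S T} hS hT := by
    change IsWeakSmall _ _
    rw [ContinuousLinearMap.add_comp, ContinuousLinearMap.comp_add, add_sub_add_comm]
    exact IsWeakSmall.add (by positivity) hS hT
  algebraMap_mem' c := by
    change IsWeakSmall _ _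
    convert isWeakSmall_zero (p / d) using 1
    ext1 u
    simp [Algebra.algebraMap_eq_smul_one]
  star_mem' {S} hS := by
    change IsWeakSmall _ _
    have h := (IsWeakSmall.adjoint hS).neg
    rw [map_sub, ContinuousLinearMap.adjoint_comp, ContinuousLinearMap.adjoint_comp,
      adjoint_besselOp, neg_sub] at h
    exact h

theorem sphereAlg_subset_commAlg {p : ℝ} (hp : 0 < p) :
    sphereAlg d ⊆ commAlg d p hp := by
  rintro S ⟨g, rfl⟩
  change IsWeakSmall _ _
  rw [besselOp, gradOp_comm, sub_self]
  exact isWeakSmall_zero _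

/-- Smooth compactly supported functions are uniformly dense in `C_0(ℝ^d)`. -/
theorem exists_contDiff_norm_sub_le (f : C₀(Rd d, ℂ)) {ε : ℝ} (hε : 0 < ε) :
    ∃ g : Rd d → ℂ, ContDiff ℝ ∞ g ∧ HasCompactSupport g ∧ ∀ x, ‖f x - g x‖ ≤ ε := by
  have hlim := f.zero_at_infty'
  have hev : ∀ᶠ x in Filter.cocompact (Rd d), ‖f x‖ < ε / 2 := by
    have := hlim.norm
    rw [norm_zero] at this
    exact this.eventually (gt_mem_nhds (half_pos hε))
  obtain ⟨K, hK, hKf⟩ := Filter.mem_cocompact.mp hev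
  obtain ⟨R, hR, hsub⟩ := hK.isBounded.subset_closedBall_lt 0 (0 : Rd d)
  let β : ContDiffBump (0 : Rd d) := ⟨R, R + 1, hR, by linarith⟩
  have hc : HasCompactSupport fun x => (β x : ℂ) * f x :=
    (β.hasCompactSupport.comp_left Complex.ofReal_zero).mul_right
  have hcont : Continuous fun x => (β x : ℂ) * f x :=
    (Complex.continuous_ofReal.comp β.continuous).mul (map_continuous f)
  have h1 : ∀ x, ‖f x - β x * f x‖ ≤ ε / 2 := fun x => by
    by_cases hx : x ∈ K
    · have : β x = 1 := β.one_of_mem_closedBall (hsub hx)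
      rw [this]
      simp
      positivity
    · have e : f x - β x * f x = ((1 - β x : ℝ) : ℂ) * f x := by
        push_cast
        ring
      rw [e, norm_mul, Complex.norm_real, Real.norm_of_nonneg (sub_nonneg.mpr β.le_one)]
      have h2 : ‖f x‖ < ε / 2 := hKf hx
      have h3 : 1 - β x ≤ 1 := by linarith [β.nonneg (x := x)]
      nlinarith [norm_nonneg (f x)]
  obtain ⟨g, hgc, hgs, hg⟩ := HasCompactSupport.exist_eLpNorm_sub_le_of_continuous
    (μ := (volume : Measure (Rd d))) (p := ∞) (half_pos hε) hc hcont
  -- The essential supremum bound holds everywhere by continuity, since a set of full measure is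
  -- dense.
  have h4 : ∀ x, ‖(β x : ℂ) * f x - g x‖ ≤ ε / 2 := by
    have hae : ∀ᵐ x : Rd d, ‖(β x : ℂ) * f x - g x‖ ≤ ε / 2 := by
      rw [eLpNorm_exponent_top] at hg
      filter_upwards [ae_le_eLpNormEssSup (f := (fun x => (β x : ℂ) * f x) - g)
        (μ := (volume : Measure (Rd d)))] with x hx
      have := hx.trans hg
      rw [← ofReal_norm, ENNReal.ofReal_le_ofReal_iff (by positivity)] at this
      exact this
    have hcl : IsClosed {x : Rd d | ‖(β x : ℂ) * f x - g x‖ ≤ ε / 2} :=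
      isClosed_le ((hcont.sub hgs.continuous).norm) continuous_const
    have hden : Dense {x : Rd d | ‖(β x : ℂ) * f x - g x‖ ≤ ε / 2} :=
      Measure.dense_of_ae hae
    intro x
    have := hcl.closure_eq ▸ hden x
    exact this
  refine ⟨g, hgs, hgc, fun x => ?_⟩
  calc ‖f x - g x‖ = ‖(f x - β x * f x) + (β x * f x - g x)‖ := by congr 1; ring
    _ ≤ ε / 2 + ε / 2 := (norm_add_le _ _).trans (add_le_add (h1 x) (h4 x))
    _ = ε := add_halves ε

/-- Constants commute with `J`, and the sup norm of a symbol controls the operator norm, so density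
of smooth compactly supported functions in `C_0` is enough. -/
theorem mulAlg_subset_closure_commAlg (hd : 0 < d) {p : ℝ} (hp : 0 < p) :
    mulAlg d ⊆ closure (commAlg d p hp : Set (L2 d →L[ℂ] L2 d)) := by
  rintro S ⟨c, f, rfl⟩
  rw [Metric.mem_closure_iff]
  intro ε hε
  obtain ⟨g, hg, hgc, hfg⟩ := exists_contDiff_norm_sub_le f (half_pos hε)
  have hgb := isBoundedBorel_of_compactSupport hg hgc
  have hfb : IsBoundedBorel fun x => f x - g x :=
    ⟨((map_continuous f).sub hg.continuous).measurable, ε / 2, hfg⟩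
  refine ⟨c • ContinuousLinearMap.id ℂ (L2 d) + mulOp g hgb, ?_, ?_⟩
  · refine add_mem (SMulMemClass.smul_mem c (one_mem (commAlg d p hp))) ?_
    exact isWeakSmall_commutator_mulOp hd hp hg hgc hgb
  · rw [dist_eq_norm, mulOp_const_add_sub (isBoundedBorel_const_add c f) hgb hfb,
      add_sub_cancel_left]
    exact (norm_mulOp_le hfb (half_pos hε).le hfg).trans_lt (half_lt_self hε)

theorem piAlg_subset_closure_commAlg (hd : 0 < d) {p : ℝ} (hp : 0 < p) :
    (PiAlg d : Set (L2 d →L[ℂ] L2 d)) ⊆ closure (commAlg d p hp : Set (L2 d →L[ℂ] L2 d)) := by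
  have h : PiAlg d ≤ (commAlg d p hp).topologicalClosure := by
    refine StarSubalgebra.topologicalClosure_minimal ?_
      (StarSubalgebra.isClosed_topologicalClosure _)
    refine StarAlgebra.adjoin_le (Set.union_subset ?_ ?_)
    · intro S hS
      exact mulAlg_subset_closure_commAlg hd hp hS
    · intro S hS
      exact subset_closure (sphereAlg_subset_commAlg hp hS)
  exact h

theorem isWeakSmall_commutator_of_mem_piAlg (hd : 0 < d) {p : ℝ} (hp : 0 < p)
    {T : L2 d →L[ℂ] L2 d} (hT : T ∈ PiAlg d) (hTc : IsCompactlySupported T) :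
    IsWeakSmall (p / d) (T ∘L besselOp d p hp - besselOp d p hp ∘L T) := by
  obtain ⟨φ, hφ, hφc, hTφ⟩ := hTc
  set J := besselOp d p hp with hJ
  set M := mulOp φ (isBoundedBorel_of_compactSupport hφ hφc) with hM
  have hα : 0 ≤ p / d := by positivity
  have hφbar : ContDiff ℝ ∞ (fun x => conj (φ x)) :=
    (Complex.conjCLE : ℂ →L[ℝ] ℂ).contDiff.comp hφ
  have hφbarc : HasCompactSupport (fun x => conj (φ x)) := hφc.comp_left (map_zero _)
  obtain ⟨C, hC, hMJ⟩ := isWeakBounded_mulOp_comp_besselOp hd hp hφ hφc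
    (isBoundedBorel_of_compactSupport hφ hφc)
  obtain ⟨D, hD, hJM⟩ : IsWeakBounded (p / d) (J ∘L M) := by
    have := (isWeakBounded_mulOp_comp_besselOp hd hp hφbar hφbarc
      (isBoundedBorel_of_compactSupport hφ hφc).conj).adjoint
    rw [ContinuousLinearMap.adjoint_comp, adjoint_besselOp, adjoint_mulOp,
      mulOp_congr (isBoundedBorel_of_compactSupport hφ hφc).conj.conj
        (isBoundedBorel_of_compactSupport hφ hφc) fun x => Complex.conj_conj _] at this
    exact this
  rw [← hM, ← hJ] at hMJ
  refine IsWeakSmall.of_forall_approx hα fun ε hε => ?_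
  -- Chosen so that the two error terms, with the constant of `RankApprox.add_half`, total at most
  -- `ε`; the `+ 1` keeps the denominator positive.
  set δ : ℝ := ε / (2 ^ (p / d) * (‖M‖ * C + D * ‖M‖) + 1) with hδ
  have hδ0 : 0 < δ := by positivity
  obtain ⟨S, hS, hTS⟩ := Metric.mem_closure_iff.mp (piAlg_subset_closure_commAlg hd hp hT) δ hδ0
  rw [dist_eq_norm] at hTS
  have hMmem : M ∈ commAlg d p hp := isWeakSmall_commutator_mulOp hd hp hφ hφc _
  -- The approximant is `M S M` rather than `S`, so that in the error the factor `T - S` has `M` on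
  -- both sides and `J` meets only `M`.
  have hS' : M * (S * M) ∈ commAlg d p hp := mul_mem hMmem (mul_mem hS hMmem)
  refine ⟨_, hS', fun n => ?_⟩
  have key : T ∘L J - J ∘L T - ((M * (S * M)) ∘L J - J ∘L (M * (S * M))) =
      (M ∘L (T - S)) ∘L (M ∘L J) + -((J ∘L M) ∘L ((T - S) ∘L M)) := by
    conv_lhs => rw [hTφ]
    ext1 u
    simp
    abel
  rw [key]
  have h1 := (hMJ (n / 2)).comp_left (M ∘L (T - S))
  have h2 := ((hJM (n / 2)).comp_right ((T - S) ∘L M)).smul (-1)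
  rw [norm_neg, norm_one, one_mul, neg_one_smul] at h2
  have hn1 : ‖M ∘L (T - S)‖ ≤ ‖M‖ * δ :=
    (ContinuousLinearMap.opNorm_comp_le _ _).trans (by gcongr)
  have hn2 : ‖(T - S) ∘L M‖ ≤ δ * ‖M‖ :=
    (ContinuousLinearMap.opNorm_comp_le _ _).trans (by gcongr)
  have h1' : RankApprox (n / 2) (‖M‖ * δ * C * (((n / 2 : ℕ) : ℝ) + 1) ^ (-(p / d)))
      ((M ∘L (T - S)) ∘L (M ∘L J)) := by
    refine h1.mono le_rfl ?_
    rw [← mul_assoc]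
    gcongr
  have h2' : RankApprox (n / 2) (D * δ * ‖M‖ * (((n / 2 : ℕ) : ℝ) + 1) ^ (-(p / d)))
      (-((J ∘L M) ∘L ((T - S) ∘L M))) := by
    refine h2.mono le_rfl ?_
    calc _ ≤ D * (((n / 2 : ℕ) : ℝ) + 1) ^ (-(p / d)) * (δ * ‖M‖) := by gcongr
      _ = _ := by ring
  refine (RankApprox.add_half hα (by positivity) (by positivity) h1' h2').mono le_rfl ?_
  gcongr
  calc 2 ^ (p / d) * (‖M‖ * δ * C + D * δ * ‖M‖)
      = δ * (2 ^ (p / d) * (‖M‖ * C + D * ‖M‖)) := by ring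
    _ ≤ δ * (2 ^ (p / d) * (‖M‖ * C + D * ‖M‖) + 1) := by gcongr; linarith
    _ = ε := by rw [hδ]; field_simp

end Commutators

end CommutatorBound

end

theorem mainTheorem8 (d : ℕ) (hd : 2 ≤ d)
    (T : CommutatorBound.L2 d →L[ℂ] CommutatorBound.L2 d)
    (hT : T ∈ CommutatorBound.PiAlg d)
    (hTc : CommutatorBound.IsCompactlySupported T)
    (p : ℝ) (hp : 0 < p) :
    T ∘L CommutatorBound.besselOp d p hp - CommutatorBound.besselOp d p hp ∘L T ∈
      CommutatorBound.weakSchattenSep (CommutatorBound.L2 d) ((d : ℝ) / p) := by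
  have hd' : 0 < d := by omega
  refine CommutatorBound.IsWeakSmall.mem_weakSchattenSep (by positivity) ?_
  rw [one_div_div]
  exact CommutatorBound.isWeakSmall_commutator_of_mem_piAlg hd' hp hT hTc
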